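/- \textbf{Setting.} Let $n\ge 1$, let $\mathbf a=(a_1,\dots,a_h)$ be a composition of $n$ into $h$ positive parts, let $0\le m\le n$, and let $\mathcal T$ be a finite planar binary tree with $h$ leaves (every vertex is a leaf or has a left and a right son; for $h=1$ it is a single vertex). The leaves, from left to right, carry the parts $a_1,\dots,a_h$. For an internal vertex $\tau$ let $s$ and $s'$ be the sums of the parts below its left and its right son. Put $A_j=\{a_1+\dots+a_{j-1}+1,\dots,a_1+\dots+a_j\}$ and $Y=\{1,\dots,m\}$. Let $\Omega_m$ be the set of $m$-subsets of $\{1,\dots,n\}$ and $\Omega_{\mathbf a}$ the set of all $(B_1,\dots,B_h)$ of pairwise disjoint subsets of $\{1,\dots,n\}$ with $|B_j|=a_j$. Let $M^{n-m,m}=L(\Omega_m)$ and $M^{\mathbf a}=L(\Omega_{\mathbf a})$ be the spaces of complex functions on them, with scalar product $\langle f_1,f_2\rangle=\sum_\omega f_1(\omega)\overline{f_2(\omega)}$. Let $S_{\mathbf a}\le S_n$ be the stabilizer of $(A_1,\dots,A_h)$ and $S_{n-m}\times S_m$ the stabilizer of $Y$. For a subgroup $K$, $M^K$ denotes the $K$-invariant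 functions in $M$. For nonnegative integers let $$E_m(a,b,c,x)=\sum_{j=\max\{0,x-c+m\}}^{\min\{m,x\}}(-1)^j\binom mj(b-m+1)_j(-x)_j(a-m+1)_{m-j}(x-c)_{m-j},\qquad (y)_r=y(y+1)\cdots(y+r-1).$$ \emph{Representation labelings.} A representation labeling $\mathbf k$ assigns to every internal vertex a nonnegative integer, and $0$ to every leaf, such that the label of the root is at most $\min\{n-m,m\}$ and, at every internal vertex with label $k$ and sons labeled $i$ (left) and $j$ (right), $$i\le s/2,\quad j\le s'/2,\quad k-s\le j-i\le s'-k,\quad i+j\le k.$$ \emph{Variables.} Given $\mathbf k$, an admissible $\mathbf w$ assigns to every internal vertex an integer $w$, where the root has space label $q=m$, a vertex with space label $q$ and variable $w$ gives the space labels $q-w$ and $w$ to its left and right son, and at every internal vertex $\max\{j,\,i-s+q\}\le w\le\min\{s'-j,\,q-i\}$. Let $\mathbf x(\mathbf w)=(x_1,\dots,x_h)$ be the resulting space labels of the leaves (for $h=1$, $x_1=m$). The multidimensional Hahn polynomial is $$E_{\mathbf k}(\mathbf w)=\prod_\tau E_{k-i-j}(s'-2j,\;s-2i,\;q-i-j,\;w-j),$$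 the product being over the internal vertices $\tau$, with $k,i,j,s,s',q,w$ taken at $\tau$. \emph{The functions.} For a tree that is a leaf with block $A$, let $\Phi(q)$ be the function that is constantly $1$ on the $q$-subsets of $A$. For a tree with root label $k$, left subtree $\mathcal T'$ and right subtree $\mathcal T''$ (with inherited blocks and labelings, and root labels $i$, $j$), define recursively $$\Phi(\mathcal T,q,\mathbf k)=\sum_{w=\max\{j,\,i-s+q\}}^{\min\{s'-j,\,q-i\}}E_{k-i-j}(s'-2j,s-2i,q-i-j,w-j)\;\Phi(\mathcal T',q-w,\mathbf k)\otimes\Phi(\mathcal T'',w,\mathbf k),$$ where, if $X',X''$ are the unions of the blocks of the two subtrees, $(\varphi\otimes\psi)(Z)=\varphi(Z\cap X')\psi(Z\cap X'')$ for $Z\subseteq X'\cup X''$ (functions being extended by $0$ to subsets of other cardinalities). Write $\Phi_{\mathbf k}=\Phi(\mathcal T,m,\mathbf k)\in M^{n-m,m}$, and define $\Psi_{\mathbf k}\in M^{\mathbf a}$ by $$\Psi_{\mathbf k}=\sum_{\mathbf w}E_{\mathbf k}(\mathbf w)\,\mathbf 1\{B\in\Omega_{\mathbf a}:|B_j\cap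 Y|=x_j(\mathbf w)\ \forall j\},$$ where the sum is over all admissible $\mathbf w$. \textbf{Statement.} \begin{enumerate} \item For every representation labeling $\mathbf k$, $\Phi_{\mathbf k}$ is $S_{\mathbf a}$-invariant and has the same Hahn coefficients as $\Psi_{\mathbf k}$: $$\Phi_{\mathbf k}=\sum_{\mathbf w}E_{\mathbf k}(\mathbf w)\,\mathbf 1\{Z\in\Omega_m:|Z\cap A_j|=x_j(\mathbf w)\ \forall j\}.$$ The change of variable $g\mapsto g^{-1}$ defines a linear isomorphism $\sharp:(M^{n-m,m})^{S_{\mathbf a}}\to(M^{\mathbf a})^{S_{n-m}\times S_m}$, $\eta\mapsto\eta^\sharp$, by $\eta^\sharp(gA_1,\dots,gA_h)=\eta(g^{-1}Y)$ for all $g\in S_n$, and $\Phi_{\mathbf k}^\sharp=\Psi_{\mathbf k}$ for every $\mathbf k$. \item The functions $\Psi_{\mathbf k}$, indexed by the representation labelings $\mathbf k$, form an orthogonal basis of $(M^{\mathbf a})^{S_{n-m}\times S_m}$. \item For every representation labeling $\mathbf k$, $$\|\Psi_{\mathbf k}\|^2_{M^{\mathbf a}}=\frac{(n-m)!\,m!}{a_1!\,a_2!\cdots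 a_h!}\;\|\Phi_{\mathbf k}\|^2_{M^{n-m,m}}.$$ \end{enumerate} -/

import Mathlib

open scoped Pointwise

namespace HahnTree

/-- Finite planar binary trees: a vertex is a leaf, or it is internal and has a left and a right
son.  (The one-vertex tree is allowed, since it occurs as a subtree.) -/
inductive PTree : Type
  | leaf : PTree
  | node : PTree → PTree → PTree

/-- The number of leaves; the leaves are numbered from left to right. -/
def PTree.leaves : PTree → ℕ
  | .leaf => 1
  | .node l r => l.leaves + r.leaves

/-- The part of a family indexed by the leaves that belongs to the left subtree. -/
def leftPart {α : Type} {l r : PTree} (a : Fin (PTree.node l r).leaves → α) : Fin l.leaves → α :=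
  fun j => a (Fin.castAdd r.leaves j)

/-- The part of a family indexed by the leaves that belongs to the right subtree. -/
def rightPart {α : Type} {l r : PTree} (a : Fin (PTree.node l r).leaves → α) : Fin r.leaves → α :=
  fun j => a (Fin.natAdd l.leaves j)

/-- Labelings of the internal vertices by natural numbers: the label of the root, together with
a labeling of the left and one of the right subtree. -/
def Labeling : PTree → Type
  | .leaf => Unit
  | .node l r => ℕ × Labeling l × Labeling r

instance Labeling.instDecidableEq : (T : PTree) → DecidableEq (Labeling T)
  | .leaf => inferInstanceAs (DecidableEq Unit)
  | .node l r =>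
    letI := Labeling.instDecidableEq l
    letI := Labeling.instDecidableEq r
    inferInstanceAs (DecidableEq (ℕ × Labeling l × Labeling r))

/-- The label of the root. -/
def Labeling.root {l r : PTree} (k : Labeling (.node l r)) : ℕ := Prod.fst k
/-- The labeling inherited by the left subtree. -/
def Labeling.left {l r : PTree} (k : Labeling (.node l r)) : Labeling l := (Prod.snd k).1
/-- The labeling inherited by the right subtree. -/
def Labeling.right {l r : PTree} (k : Labeling (.node l r)) : Labeling r := (Prod.snd k).2

/-- The representation label of the root, where a leaf has the label `0`. -/
def repLabel : (T : PTree) → Labeling T → ℕ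
  | .leaf, _ => 0
  | .node _ _, k => k.root

/-- The conditions on a representation labeling at all internal vertices.  At a vertex with label
`k`, whose sons have labels `i`, `j` (`0` for a leaf), where the parts of the composition below
the left and right son sum to `s` and `s'`: `i ≤ s / 2`, `j ≤ s' / 2`, `k - s ≤ j - i ≤ s' - k`
and `i + j ≤ k`. -/
def RepCond : (T : PTree) → (Fin T.leaves → ℕ) → Labeling T → Prop
  | .leaf, _, _ => True
  | .node l r, a, k =>
      2 * repLabel l k.left ≤ ∑ p, leftPart a p ∧
      2 * repLabel r k.right ≤ ∑ p, rightPart a p ∧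
      (k.root : ℤ) - ((∑ p, leftPart a p : ℕ) : ℤ) ≤ (repLabel r k.right : ℤ) - repLabel l k.left ∧
      (repLabel r k.right : ℤ) - repLabel l k.left ≤ ((∑ p, rightPart a p : ℕ) : ℤ) - k.root ∧
      repLabel l k.left + repLabel r k.right ≤ k.root ∧
      RepCond l (leftPart a) k.left ∧ RepCond r (rightPart a) k.right

/-- Representation labelings of the tree `T` with composition `a` of `n` and space label `m` of
the root: `0 ≤ k ≤ min (n - m) m` at the root, and `RepCond`. -/
def IsRepLabeling (T : PTree) (n : ℕ) (a : Fin T.leaves → ℕ) (m : ℕ) (k : Labeling T) : Prop :=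
  repLabel T k ≤ min (n - m) m ∧ RepCond T a k

/-- The range `max {j, i - s + m} ≤ w ≤ min {s' - j, m - i}` of the variable of an internal vertex
with space label `m`, sons with representation labels `i`, `j`, and sums of parts `s`, `s'`.
The subtractions are not truncated when `i ≤ m` and `j ≤ s'`, as always holds below. -/
def varRange (s s' m i j : ℕ) : Finset ℕ :=
  Finset.Icc (max j (i + m - s)) (min (s' - j) (m - i))

/-- All admissible values of the variables `w`: if an internal vertex has space label `m` and
variable `w` in the range above, its left son has space label `m - w` and its right son `w`. -/
def varLabelings : (T : PTree) → (Fin T.leaves → ℕ) → ℕ → Labeling T → Finset (Labeling T)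
  | .leaf, _, _, _ => ({()} : Finset Unit)
  | .node l r, a, m, k =>
      (varRange (∑ p, leftPart a p) (∑ p, rightPart a p) m
        (repLabel l k.left) (repLabel r k.right)).biUnion fun w =>
          (({w} : Finset ℕ) ×ˢ (varLabelings l (leftPart a) (m - w) k.left ×ˢ
            varLabelings r (rightPart a) w k.right) : Finset (ℕ × Labeling l × Labeling r))

/-- The space labels of the leaves: `m - w` at a left son and `w` at a right son of a vertex with
space label `m` and variable `w`. -/
def leafCounts : (T : PTree) → ℕ → Labeling T → Fin T.leaves → ℕ
  | .leaf, m, _ => fun _ => m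
  | .node l r, m, w =>
      (Fin.append (leafCounts l (m - w.root) w.left) (leafCounts r w.root w.right) :
        Fin (l.leaves + r.leaves) → ℕ)

/-- `(x)_k = x (x + 1) ⋯ (x + k - 1)`. -/
def rising (x : ℤ) (k : ℕ) : ℤ := ∏ i ∈ Finset.range k, (x + (i : ℤ))

/-- The Hahn polynomials `E_m(a, b, c, x)`.  The lower limit is `max {0, x - c + m}`. -/
def hahn (m a b c x : ℕ) : ℤ :=
  ∑ j ∈ Finset.Icc (x + m - c) (min m x),
    (-1) ^ j * (m.choose j : ℤ) * rising ((b : ℤ) - m + 1) j * rising (-(x : ℤ)) j *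
      rising ((a : ℤ) - m + 1) (m - j) * rising ((x : ℤ) - c) (m - j)

/-- The factor `E_{k-i-j}(s' - 2j, s - 2i, m - i - j, w - j)` of an internal vertex. -/
def vertexHahn (s s' m k i j w : ℕ) : ℤ :=
  hahn (k - i - j) (s' - 2 * j) (s - 2 * i) (m - i - j) (w - j)

/-- The multidimensional Hahn polynomial of the tree `T` with composition `a`, space label `m` of
the root, representation labeling `k` and variables `w`. -/
def multiHahn : (T : PTree) → (Fin T.leaves → ℕ) → ℕ → Labeling T → Labeling T → ℤ
  | .leaf, _, _, _, _ => 1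
  | .node l r, a, m, k, w =>
      vertexHahn (∑ p, leftPart a p) (∑ p, rightPart a p) m k.root
          (repLabel l k.left) (repLabel r k.right) w.root *
        multiHahn l (leftPart a) (m - w.root) k.left w.left *
        multiHahn r (rightPart a) w.root k.right w.right

section Modules

variable {n : ℕ}

/-- Functions on the `q`-subsets of `X` are extended by `0` to all finite subsets: `σ_q(X)` is the
characteristic function of the set of all `q`-subsets of `X`. -/
def sigma (q : ℕ) (X : Finset (Fin n)) : Finset (Fin n) → ℂ :=
  fun Z => if Z ⊆ X ∧ Z.card = q then 1 else 0

/-- The tensor product of a function `φ` of subsets of `X` and a function `ψ` of subsets of `X'`,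
for disjoint `X` and `X'`, as a function of subsets of `X ∪ X'`. -/
def tensor (X X' : Finset (Fin n)) (φ ψ : Finset (Fin n) → ℂ) : Finset (Fin n) → ℂ :=
  fun Z => if Z ⊆ X ∪ X' then φ (Z ∩ X) * ψ (Z ∩ X') else 0

/-- The recursive definition of `Φ`, for a tree whose leaves carry the parts `a` and disjoint
blocks `A` with `a j` elements; it is a function of the `m`-subsets of the union of the blocks. -/
noncomputable def phiAux : (T : PTree) → (Fin T.leaves → ℕ) → (Fin T.leaves → Finset (Fin n)) →
    ℕ → Labeling T → Finset (Fin n) → ℂ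
  | .leaf, _, A, m, _ => sigma m (A (0 : Fin 1))
  | .node l r, a, A, m, k =>
      ∑ w ∈ varRange (∑ p, leftPart a p) (∑ p, rightPart a p) m
          (repLabel l k.left) (repLabel r k.right),
        (vertexHahn (∑ p, leftPart a p) (∑ p, rightPart a p) m k.root
          (repLabel l k.left) (repLabel r k.right) w : ℂ) •
        tensor (Finset.univ.biUnion (leftPart A)) (Finset.univ.biUnion (rightPart A))
          (phiAux l (leftPart a) (leftPart A) (m - w) k.left)
          (phiAux r (rightPart a) (rightPart A) w k.right)

/-- `Ω_a`: the ordered set partitions `(B_1, …, B_h)` of `{1, …, n}` with `|B_j| = a_j`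
(that their union is everything is automatic when the `a_j` sum to `n`). -/
abbrev OmegaComp (n : ℕ) {h : ℕ} (a : Fin h → ℕ) : Type :=
  {B : Fin h → Finset (Fin n) // (∀ j, (B j).card = a j) ∧ ∀ i j, i ≠ j → Disjoint (B i) (B j)}

instance OmegaComp.instMulAction {h : ℕ} (a : Fin h → ℕ) :
    MulAction (Equiv.Perm (Fin n)) (OmegaComp n a) where
  smul g B := ⟨fun j => g • B.1 j, fun j => by simpa using B.2.1 j, fun i j hij => by
    simpa [Finset.smul_finset_def] using
      (Finset.disjoint_image (MulAction.injective g)).2 (B.2.2 i j hij)⟩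
  one_smul B := Subtype.ext (funext fun j => one_smul _ (B.1 j))
  mul_smul g g' B := Subtype.ext (funext fun j => mul_smul g g' (B.1 j))

/-- `A_j = {a_1 + ⋯ + a_{j-1} + 1, …, a_1 + ⋯ + a_j}`, where `Fin n` stands for `{1, …, n}`. -/
def block (n : ℕ) {h : ℕ} (a : Fin h → ℕ) (j : Fin h) : Finset (Fin n) :=
  Finset.univ.filter fun x =>
    ∑ i ∈ Finset.Iio j, a i ≤ (x : ℕ) ∧ (x : ℕ) < ∑ i ∈ Finset.Iic j, a i

theorem sum_Iic_eq {h : ℕ} (a : Fin h → ℕ) (j : Fin h) :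
    ∑ i ∈ Finset.Iic j, a i = ∑ i ∈ Finset.Iio j, a i + a j := by
  rw [← Finset.Iio_insert, Finset.sum_insert (by simp), add_comm]

theorem card_block {h : ℕ} (a : Fin h → ℕ) (ha : ∑ j, a j = n) (j : Fin h) :
    (block n a j).card = a j := by
  have hle : ∑ i ∈ Finset.Iic j, a i ≤ n :=
    ha ▸ Finset.sum_le_sum_of_subset (Finset.subset_univ _)
  have : (block n a j).map Fin.valEmbedding =
      Finset.Ico (∑ i ∈ Finset.Iio j, a i) (∑ i ∈ Finset.Iic j, a i) := by
    ext x
    simp only [block, Finset.mem_map, Finset.mem_filter, Finset.mem_univ, true_and,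
      Fin.valEmbedding_apply, Finset.mem_Ico]
    constructor
    · rintro ⟨y, hy, rfl⟩
      exact hy
    · intro hx
      exact ⟨⟨x, hx.2.trans_le hle⟩, hx, rfl⟩
  rw [← Finset.card_map Fin.valEmbedding, this, Nat.card_Ico, sum_Iic_eq]
  omega

theorem disjoint_block {h : ℕ} (a : Fin h → ℕ) {i j : Fin h} (hij : i ≠ j) :
    Disjoint (block n a i) (block n a j) := by
  have key : ∀ {i j : Fin h}, i < j → Disjoint (block n a i) (block n a j) := by
    intro i j hij
    have hs : ∑ p ∈ Finset.Iic i, a p ≤ ∑ p ∈ Finset.Iio j, a p :=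
      Finset.sum_le_sum_of_subset fun p hp => by
        simp only [Finset.mem_Iic, Finset.mem_Iio] at hp ⊢
        exact hp.trans_lt hij
    refine Finset.disjoint_left.2 fun x hx hx' => ?_
    simp only [block, Finset.mem_filter] at hx hx'
    omega
  rcases lt_or_gt_of_ne hij with hlt | hgt
  · exact key hlt
  · exact (key hgt).symm

/-- The point `(A_1, …, A_h)` of `Ω_a`. -/
def basePartition {h : ℕ} (a : Fin h → ℕ) (ha : ∑ j, a j = n) : OmegaComp n a :=
  ⟨block n a, card_block a ha, fun _ _ hij => disjoint_block a hij⟩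

/-- The point `Y = {1, …, m}` of `Ω_m`, where `Ω_m` is `Set.powersetCard (Fin n) m`. -/
def baseSubset (m : ℕ) (hm : m ≤ n) : Set.powersetCard (Fin n) m :=
  ⟨Finset.univ.filter fun x => (x : ℕ) < m, by
    rw [Set.powersetCard.mem_iff, Fin.card_filter_val_lt, min_eq_right hm]⟩

/-- The functions on a finite `G`-set `X` that are invariant under the subgroup `K`. -/
def invariantFns {G X : Type} [Group G] [MulAction G X] [Fintype X] (K : Subgroup G) :
    Submodule ℂ (EuclideanSpace ℂ X) where
  carrier := {f | ∀ g ∈ K, ∀ x, f (g • x) = f x}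
  add_mem' hf hf' g hg x := by simp [hf g hg x, hf' g hg x]
  zero_mem' _ _ _ := by simp
  smul_mem' c f hf g hg x := by simp [hf g hg x]

/-- `Φ(T(a), m, T_r(k))` as an element of `M^{n-m,m}`. -/
noncomputable def Phi (n : ℕ) (T : PTree) (a : Fin T.leaves → ℕ) (m : ℕ) (k : Labeling T) :
    EuclideanSpace ℂ (Set.powersetCard (Fin n) m) :=
  WithLp.toLp 2 fun Z => phiAux T a (block n a) m k Z.1

/-- `σ_{x_1}(A_1) ⊗ ⋯ ⊗ σ_{x_h}(A_h)` in `M^{n-m,m}`: the characteristic function of the set of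
all `Z` such that `|Z ∩ A_j| = x_j` for all `j`. -/
noncomputable def sigmaBlocks (n : ℕ) {h : ℕ} (a : Fin h → ℕ) (m : ℕ) (x : Fin h → ℕ) :
    EuclideanSpace ℂ (Set.powersetCard (Fin n) m) :=
  WithLp.toLp 2 fun Z => if ∀ j, (Z.1 ∩ block n a j).card = x j then 1 else 0

/-- `σ_x(Y) ⊗ σ_{a-x}(Yᶜ)` in `M^a`, where `Y = {1, …, m}`: the characteristic function of the
set of all `B` such that `|B_j ∩ Y| = x_j` for all `j`. -/
noncomputable def sigmaComp (n : ℕ) {h : ℕ} (a : Fin h → ℕ) (m : ℕ) (hm : m ≤ n)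
    (x : Fin h → ℕ) : EuclideanSpace ℂ (OmegaComp n a) :=
  WithLp.toLp 2 fun B => if ∀ j, (B.1 j ∩ (baseSubset m hm).1).card = x j then 1 else 0

/-- `Ψ(T(a), m, T_r(k))` in `M^a`. -/
noncomputable def Psi (n : ℕ) (T : PTree) (a : Fin T.leaves → ℕ) (m : ℕ) (hm : m ≤ n)
    (k : Labeling T) : EuclideanSpace ℂ (OmegaComp n a) :=
  ∑ w ∈ varLabelings T a m k,
    (multiHahn T a m k w : ℂ) • sigmaComp n a m hm (leafCounts T m w)

end Modules

end HahnTree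

namespace HahnTree

/-! The argument has a one-variable part, an induction over the tree, and a transfer between two
transitive actions of the symmetric group.

One variable. Consider `c`-subsets of a disjoint union of an `a`-set and a `b`-set, and functions of
the number `x` of points in the `a`-set. Summing over subsets with one point less and over supersets
with one point more gives operators in `c` that are adjoint for the weight `C(a,x) C(b,c-x)`
(`sum_up_eq_sum_down`). By `hahnPoly_up` and `hahnPoly_down` both send a Hahn polynomial to a
multiple of the one of the same degree with `c` shifted. The resulting recursion in `c`
(`hahnInner_succ`) forces different degrees to be orthogonal, and shows that the squared norm
depends on `c` only through a binomial coefficient (`hahnInner_self`).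

Tree. This binomial coefficient makes the induction close. The squared norm of `Φ(q)` with root
label `k` is `C(n-2k, q-k)` times a constant independent of `q` (`treeNorm`). At a vertex, terms
with different `w` have disjoint supports, and the product of the binomial coefficients of the two
sons is exactly the Hahn weight with parameters `s'-2j`, `s-2i`. So the sum over `w` is again a Hahn
scalar product (`subsetInner_phiAux`). For fixed subtree labelings and fixed `q` there are as many
possible root labels as values of `w`, so orthogonality makes a square matrix invertible, which
gives spanning (`exists_hahn_expansion`, `blockChar_mem_span`).

Transfer. Both spaces of invariants consist of functions on double cosets in the symmetric group,
exchanged by inversion. Inversion preserves sums over the group, so `sharpEquiv` multiplies scalar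
products by `|Ω_a| / |Ω_m|`. It sends `Φ` to `Ψ` because it matches the characteristic functions in
their common expansion. -/

/-! ### One-variable Hahn polynomials: shifts in `c`, orthogonality, completeness. -/

theorem rising_succ (x : ℤ) (k : ℕ) : rising x (k + 1) = rising x k * (x + k) :=
  Finset.prod_range_succ _ _

theorem mul_rising_add_one (x : ℤ) (k : ℕ) : x * rising (x + 1) k = rising x k * (x + k) := by
  rw [← rising_succ, rising, rising, Finset.prod_range_succ']
  simp only [Nat.cast_add, Nat.cast_one, Nat.cast_zero, add_zero]
  rw [mul_comm]
  congr 1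
  exact Finset.prod_congr rfl fun i _ => by ring

theorem rising_neg_eq_zero {x k : ℕ} (h : x < k) : rising (-(x : ℤ)) k = 0 :=
  Finset.prod_eq_zero (Finset.mem_range.2 h) (by simp)

theorem rising_pos {x : ℤ} (hx : 0 < x) (k : ℕ) : 0 < rising x k :=
  Finset.prod_pos fun i _ => by positivity

/-- The Hahn polynomial as a polynomial in all its parameters. -/
def hahnPoly (m : ℕ) (a b c x : ℤ) : ℤ :=
  ∑ j ∈ Finset.range (m + 1),
    (-1) ^ j * (m.choose j : ℤ) * rising (b - m + 1) j * rising (-x) j *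
      rising (a - m + 1) (m - j) * rising (x - c) (m - j)

theorem rising_sub_eq_zero {x c k : ℕ} (hx : x ≤ c) (h : c < x + k) :
    rising ((x : ℤ) - c) k = 0 := by
  obtain ⟨d, rfl⟩ := Nat.exists_eq_add_of_le hx
  have := rising_neg_eq_zero (x := d) (k := k) (by omega)
  rw [← this]
  congr 1
  push_cast
  ring

/-- The limits of summation in `hahn` only omit zero terms: below the lower limit `(x-c)_{m-j}` has
a factor `0`, above the upper one `(-x)_j` has. -/
theorem hahn_eq_hahnPoly (m a b : ℕ) {c x : ℕ} (hx : x ≤ c) :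
    hahn m a b c x = hahnPoly m a b c x := by
  refine Finset.sum_subset (fun j hj => ?_) fun j hj hj' => ?_
  · simp only [Finset.mem_Icc, Finset.mem_range] at hj ⊢
    omega
  · simp only [Finset.mem_Icc, Finset.mem_range, not_and_or, not_le] at hj hj'
    rcases hj' with h | h
    · rw [rising_sub_eq_zero (k := m - j) hx (by omega), mul_zero]
    · rw [rising_neg_eq_zero (x := x) (k := j) (by omega)]
      ring

/-- Since `m > c`, every `j ≤ m` has `j > x` or `m - j > c - x`, so one rising factorial vanishes.
This starts the inductions on `c`. -/
theorem hahnPoly_eq_zero (m : ℕ) (a b : ℤ) {c x : ℕ} (hx : x ≤ c) (hc : c < m) :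
    hahnPoly m a b c x = 0 := by
  refine Finset.sum_eq_zero fun j hj => ?_
  by_cases h : x < j
  · rw [rising_neg_eq_zero h]
    ring
  · rw [rising_sub_eq_zero (k := m - j) hx (by omega), mul_zero]

/-- The raising relation. -/
theorem hahnPoly_up (m : ℕ) (a b c x : ℤ) :
    x * hahnPoly m a b c (x - 1) + (c + 1 - x) * hahnPoly m a b c x =
      (c + 1 - m) * hahnPoly m a b (c + 1) x := by
  simp only [hahnPoly, Finset.mul_sum]
  rw [← Finset.sum_add_distrib]
  refine Finset.sum_congr rfl fun j hj => ?_
  have hj : j ≤ m := by simpa [Nat.lt_succ_iff] using hj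
  -- The identity holds for each `j` separately: relative to `(-x)_j (x-c-1)_{m-j}` the two terms
  -- have the factors `x - j` and `c + 1 - x - (m - j)`, whose sum `c + 1 - m` is free of `j` and
  -- `x`.
  have h1 := mul_rising_add_one (-x) j
  have h2 := mul_rising_add_one (x - (c + 1)) (m - j)
  rw [Nat.cast_sub hj] at h2
  rw [show -(x - 1) = -x + 1 by ring, show x - 1 - c = x - (c + 1) by ring,
    show x - c = x - (c + 1) + 1 by ring]
  linear_combination (-(-1) ^ j * (m.choose j : ℤ) * rising (b - m + 1) j *
      rising (a - m + 1) (m - j) * rising (x - (c + 1)) (m - j)) * h1 -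
      ((-1) ^ j * (m.choose j : ℤ) * rising (b - m + 1) j *
      rising (a - m + 1) (m - j) * rising (-x) j) * h2

theorem rising_neg_self (m : ℕ) : rising (-(m : ℤ)) m = (-1) ^ m * m.factorial := by
  induction m with
  | zero => simp [rising]
  | succ m ih =>
    have h := mul_rising_add_one (-((m + 1 : ℕ) : ℤ)) m
    rw [← rising_succ] at h
    rw [← h, show (-((m + 1 : ℕ) : ℤ)) + 1 = -(m : ℤ) by push_cast; ring, ih,
      Nat.factorial_succ]
    push_cast
    ring

/-- For `c = m` the two vanishing conditions leave only the term `j = x`. The product form supplies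
the boundary case of `hahnPoly_down` and the positivity of the norms. -/
theorem hahnPoly_self (a b : ℤ) {m x : ℕ} (hx : x ≤ m) :
    hahnPoly m a b m x =
      (-1) ^ m * m.factorial * ((-1) ^ x * rising (b - m + 1) x * rising (a - m + 1) (m - x)) := by
  rw [hahnPoly, Finset.sum_eq_single x]
  · obtain ⟨y, rfl⟩ := Nat.exists_eq_add_of_le hx
    have h2 : ((x : ℤ) - ((x + y : ℕ) : ℤ)) = -(y : ℤ) := by push_cast; ring
    rw [h2, rising_neg_self, Nat.add_sub_cancel_left, rising_neg_self]
    rw [← Nat.add_choose_mul_factorial_mul_factorial x y, Nat.choose_symm_add]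
    push_cast
    ring
  · intro j hj hne
    rcases lt_or_gt_of_ne hne with h | h
    · rw [rising_sub_eq_zero (k := m - j) hx (by omega), mul_zero]
    · rw [rising_neg_eq_zero h]
      ring
  · intro h
    simp at h
    omega

/-- The lowering relation. -/
theorem hahnPoly_down (m : ℕ) (a b : ℤ) {c x : ℕ} (hx : x ≤ c) :
    (a - x) * hahnPoly m a b (c + 1) (x + 1) + (b - c + x) * hahnPoly m a b (c + 1) x =
      (a + b - m - c) * hahnPoly m a b c x := by
  induction c generalizing x with
  | zero =>
    obtain rfl : x = 0 := by omega
    rcases m with _ | _ | m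
    · simp [hahnPoly, rising]
    · have h1 := hahnPoly_self a b (m := 1) (x := 1) le_rfl
      have h0 := hahnPoly_self a b (m := 1) (x := 0) (by omega)
      have hz := hahnPoly_eq_zero 1 a b (c := 0) (x := 0) le_rfl (by omega)
      simp [rising] at h1 h0 hz ⊢
      rw [h1, h0, hz]
      ring
    · have h1 := hahnPoly_eq_zero (m + 2) a b (c := 1) (x := 1) le_rfl (by omega)
      have h0 := hahnPoly_eq_zero (m + 2) a b (c := 1) (x := 0) (by omega) (by omega)
      have hz := hahnPoly_eq_zero (m + 2) a b (c := 0) (x := 0) le_rfl (by omega)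
      simp at h1 h0 hz ⊢
      rw [h1, h0, hz]
      ring
  | succ c ih =>
    -- Below the degree everything is zero. At `c + 2 = m` the right side is zero and the left side
    -- is explicit. Above, the raising relation expresses the values at `c + 2` by those at `c + 1`,
    -- where induction applies.
    rcases lt_trichotomy (c + 2) m with h | h | h
    · have h1 := hahnPoly_eq_zero m a b (c := c + 2) (x := x + 1) (by omega) h
      have h0 := hahnPoly_eq_zero m a b (c := c + 2) (x := x) (by omega) h
      have hz := hahnPoly_eq_zero m a b (c := c + 1) (x := x) (by omega) (by omega)
      push_cast at h1 h0 hz ⊢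
      rw [show (c : ℤ) + 1 + 1 = c + 2 by ring, h1, h0, hz]
      ring
    · subst h
      have h1 := hahnPoly_self a b (m := c + 2) (x := x + 1) (by omega)
      have h0 := hahnPoly_self a b (m := c + 2) (x := x) (by omega)
      have hz := hahnPoly_eq_zero (c + 2) a b (c := c + 1) (x := x) (by omega) (by omega)
      rw [rising_succ] at h1
      rw [show c + 2 - x = (c + 1 - x) + 1 by omega, rising_succ,
        Nat.cast_sub hx] at h0
      rw [show c + 2 - (x + 1) = c + 1 - x by omega] at h1
      push_cast at h1 h0 hz ⊢
      rw [show (c : ℤ) + 1 + 1 = c + 2 by ring, h1, h0, hz]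
      ring
    · have hne : ((c : ℤ) + 2 - m) ≠ 0 := by omega
      refine mul_left_cancel₀ hne ?_
      have u1 := hahnPoly_up m a b (c + 1) (x + 1)
      have u0 := hahnPoly_up m a b (c + 1) x
      have u2 := hahnPoly_up m a b c x
      -- The induction hypothesis at `x` and, in `d1`, at `x - 1`. The factors `c + 1 - x` and `x`
      -- cover the end points `x = c + 1` and `x = 0`, where it is not available.
      have d0 : ((c : ℤ) + 1 - x) * ((a - x) * hahnPoly m a b (c + 1) (x + 1) +
          (b - c + x) * hahnPoly m a b (c + 1) x - (a + b - m - c) * hahnPoly m a b c x) = 0 := by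
        rcases Nat.lt_or_ge c x with h | h
        · rw [show (x : ℤ) = c + 1 by omega]
          ring
        · rw [ih h]
          ring
      have d1 : (x : ℤ) * ((a - x + 1) * hahnPoly m a b (c + 1) x +
          (b - c + x - 1) * hahnPoly m a b (c + 1) (x - 1) -
          (a + b - m - c) * hahnPoly m a b c (x - 1)) = 0 := by
        rcases x with _ | x
        · simp
        · have := ih (x := x) (by omega)
          push_cast
          rw [show (x : ℤ) + 1 - 1 = x by ring]
          linear_combination ((x : ℤ) + 1) * this
      rw [show (x : ℤ) + 1 - 1 = x by ring] at u1
      push_cast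
      linear_combination -(a - x) * u1 - (b - c - 1 + x) * u0 + d0 + d1 + (a + b - m - c) * u2

/-- The scalar product of two Hahn polynomials for the hypergeometric weight. -/
def hahnInner (m m' a b c : ℕ) : ℤ :=
  ∑ x ∈ Finset.range (c + 1), (a.choose x : ℤ) * (b.choose (c - x) : ℤ) *
    (hahnPoly m a b c x * hahnPoly m' a b c x)

theorem succ_mul_choose_int (a x : ℕ) :
    ((x : ℤ) + 1) * (a.choose (x + 1) : ℤ) = (a.choose x : ℤ) * ((a : ℤ) - x) := by
  rcases le_or_gt x a with h | h
  · have := Nat.choose_succ_right_eq a x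
    zify [h] at this
    linear_combination this
  · simp [Nat.choose_eq_zero_of_lt h, Nat.choose_eq_zero_of_lt (h.trans (Nat.lt_succ_self x))]

/-- Adjointness of the two operators: shift the summation variable and absorb factors by `(x+1)
C(a,x+1) = (a-x) C(a,x)`. The terms lost at the ends have the coefficients `x = 0` and `c + 1 - x =
0`. -/
theorem sum_up_eq_sum_down (a b c : ℕ) (f g : ℤ → ℤ) :
    ∑ x ∈ Finset.range (c + 2), (a.choose x : ℤ) * (b.choose (c + 1 - x) : ℤ) *
        ((x * f (x - 1) + (c + 1 - x) * f x) * g x) =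
      ∑ x ∈ Finset.range (c + 1), (a.choose x : ℤ) * (b.choose (c - x) : ℤ) *
        (f x * ((a - x) * g (x + 1) + (b - (c - x)) * g x)) := by
  simp only [add_mul, mul_add, Finset.sum_add_distrib]
  congr 1
  · rw [Finset.sum_range_succ']
    simp only [Nat.cast_zero, zero_mul, mul_zero, add_zero]
    refine Finset.sum_congr rfl fun x _ => ?_
    have := succ_mul_choose_int a x
    rw [Nat.add_sub_add_right]
    push_cast
    rw [show (x : ℤ) + 1 - 1 = x by ring]
    linear_combination ((b.choose (c - x) : ℤ) * f x * g (x + 1)) * this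
  · rw [Finset.sum_range_succ]
    simp only [Nat.cast_add, Nat.cast_one, sub_self, zero_mul, mul_zero, add_zero]
    refine Finset.sum_congr rfl fun x hx => ?_
    have hx : x ≤ c := by simpa [Nat.lt_succ_iff] using hx
    have := succ_mul_choose_int b (c - x)
    rw [show c - x + 1 = c + 1 - x by omega, Nat.cast_sub hx] at this
    linear_combination ((a.choose x : ℤ) * f x * g x) * this

/-- Adjointness with the raising relation used for degree `m` and the lowering relation for degree
`m'`. The asymmetry between `m` and `m'` is what yields orthogonality. -/
theorem hahnInner_succ (m m' a b c : ℕ) :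
    ((c : ℤ) + 1 - m) * hahnInner m m' a b (c + 1) =
      ((a : ℤ) + b - m' - c) * hahnInner m m' a b c := by
  have h := sum_up_eq_sum_down a b c (fun x => hahnPoly m a b c x)
    (fun x => hahnPoly m' a b (c + 1) x)
  simp only [hahnPoly_up] at h
  rw [hahnInner, hahnInner, Finset.mul_sum, Finset.mul_sum]
  push_cast
  convert h using 1
  · exact Finset.sum_congr rfl fun x _ => by ring
  · refine Finset.sum_congr rfl fun x hx => ?_
    have := hahnPoly_down m' (a : ℤ) b (c := c) (x := x) (by simpa [Nat.lt_succ_iff] using hx)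
    linear_combination -((a.choose x : ℤ) * (b.choose (c - x) : ℤ) * hahnPoly m a b c x) * this

/-- For `c < m'` the polynomial of degree `m'` is zero. From there the recursion propagates the
zero, because its coefficient `c + 1 - m` does not vanish once `c + 1 ≥ m' > m`. -/
theorem hahnInner_eq_zero_of_lt {m m' : ℕ} (a b c : ℕ) (h : m < m') :
    hahnInner m m' a b c = 0 := by
  have hz : ∀ c < m', hahnInner m m' a b c = 0 := fun c hc =>
    Finset.sum_eq_zero fun x hx => by
      rw [hahnPoly_eq_zero m' a b (by simpa [Nat.lt_succ_iff] using hx) hc]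
      ring
  induction c with
  | zero => exact hz 0 (by omega)
  | succ c ih =>
    rcases Nat.lt_or_ge (c + 1) m' with hc | hc
    · exact hz _ hc
    · have := hahnInner_succ m m' a b c
      rw [ih, mul_zero] at this
      exact (mul_eq_zero.1 this).resolve_left (by omega)

theorem hahnInner_comm (m m' a b c : ℕ) : hahnInner m m' a b c = hahnInner m' m a b c :=
  Finset.sum_congr rfl fun x _ => by ring

theorem hahnInner_eq_zero {m m' : ℕ} (a b c : ℕ) (h : m ≠ m') : hahnInner m m' a b c = 0 := by
  rcases lt_or_gt_of_ne h with h | h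
  · exact hahnInner_eq_zero_of_lt a b c h
  · rw [hahnInner_comm]
    exact hahnInner_eq_zero_of_lt a b c h

/-- The recursion in `c` is the one satisfied by the binomial coefficient, so both sides agree once
they agree at `c = m`. -/
theorem hahnInner_self {m a b c : ℕ} (hmc : m ≤ c) (hab : 2 * m ≤ a + b) :
    hahnInner m m a b c = ((a + b - 2 * m).choose (c - m) : ℤ) * hahnInner m m a b m := by
  induction c, hmc using Nat.le_induction with
  | base => simp
  | succ c hc ih =>
    have h := hahnInner_succ m m a b c
    have hne : ((c : ℤ) + 1 - m) ≠ 0 := by omega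
    refine mul_left_cancel₀ hne ?_
    have h2 := succ_mul_choose_int (a + b - 2 * m) (c - m)
    rw [show c - m + 1 = c + 1 - m by omega, Nat.cast_sub hc, Nat.cast_sub hab] at h2
    push_cast at h2
    rw [h, ih]
    linear_combination -hahnInner m m a b m * h2

theorem hahnInner_base_pos {m a b : ℕ} (ha : m ≤ a) (hb : m ≤ b) : 0 < hahnInner m m a b m := by
  refine Finset.sum_pos (fun x hx => ?_) (by simp)
  have hx : x ≤ m := by simpa [Nat.lt_succ_iff] using hx
  have h1 : (0 : ℤ) < a.choose x := by exact_mod_cast Nat.choose_pos (hx.trans ha)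
  have h2 : (0 : ℤ) < b.choose (m - x) := by exact_mod_cast Nat.choose_pos (by omega)
  have h3 : hahnPoly m a b m x ≠ 0 := by
    rw [hahnPoly_self _ _ hx]
    have := rising_pos (x := (b : ℤ) - m + 1) (by omega) x
    have := rising_pos (x := (a : ℤ) - m + 1) (by omega) (m - x)
    positivity
  have h4 := mul_self_pos.2 h3
  positivity

/-- Outside the interval one of the binomial weights is zero; inside, `x ≤ c` and the two forms of
the polynomial agree. -/
theorem hahnInner_eq_sum_Icc (m m' : ℕ) {a b c : ℕ} :
    hahnInner m m' a b c = ∑ x ∈ Finset.Icc (c - b) (min a c),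
      (a.choose x : ℤ) * (b.choose (c - x) : ℤ) * (hahn m a b c x * hahn m' a b c x) := by
  symm
  rw [hahnInner]
  refine Finset.sum_subset_zero_on_sdiff (fun x hx => ?_) (fun x hx => ?_) fun x hx => ?_
  · simp only [Finset.mem_Icc, Finset.mem_range] at hx ⊢
    omega
  · simp only [Finset.mem_sdiff, Finset.mem_Icc, Finset.mem_range] at hx
    rcases Nat.lt_or_ge a x with h | h
    · simp [Nat.choose_eq_zero_of_lt h]
    · rw [Nat.choose_eq_zero_of_lt (n := b) (k := c - x) (by omega)]
      simp
  · simp only [Finset.mem_Icc] at hx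
    rw [hahn_eq_hahnPoly m a b (by omega), hahn_eq_hahnPoly m' a b (by omega)]

/-- The Hahn polynomials of admissible degrees span the functions of the variable. -/
theorem exists_hahn_expansion {a b c : ℕ} (hc : c ≤ a + b) {x₀ : ℕ}
    (hx₀ : x₀ ∈ Finset.Icc (c - b) (min a c)) :
    ∃ d : ℕ → ℂ, ∀ x ∈ Finset.Icc (c - b) (min a c),
      ∑ μ ∈ Finset.range (min (min a b) (min c (a + b - c)) + 1), d μ * (hahn μ a b c x : ℂ) =
        if x = x₀ then 1 else 0 := by
  set N := min (min a b) (min c (a + b - c)) + 1 with hN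
  -- There are `N` values of `x`, as many as the degrees in use: `min a c - max 0 (c - b)` equals
  -- `min (min a b) (min c (a + b - c))`. Hence the matrices below are square.
  have hIcc : Finset.Icc (c - b) (min a c) = (Finset.range N).image (c - b + ·) := by
    ext x
    simp only [Finset.mem_Icc, Finset.mem_image, Finset.mem_range]
    constructor
    · intro h
      exact ⟨x - (c - b), by omega, by omega⟩
    · rintro ⟨y, hy, rfl⟩
      omega
  set W : ℕ → ℂ := fun x => (a.choose x : ℂ) * (b.choose (c - x) : ℂ)
  set P : Matrix (Fin N) (Fin N) ℂ := fun μ t => (hahn μ a b c (c - b + t) : ℂ)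
  set Q : Matrix (Fin N) (Fin N) ℂ := fun t μ =>
    W (c - b + t) * (hahn μ a b c (c - b + t) : ℂ) / (hahnInner μ μ a b c : ℂ)
  have hPQ : P * Q = 1 := by
    ext μ ν
    have h1 : (P * Q) μ ν = (hahnInner μ ν a b c : ℂ) / (hahnInner ν ν a b c : ℂ) := by
      rw [hahnInner_eq_sum_Icc μ ν, hIcc, Finset.sum_image (by intro x _ y _ h; simpa using h),
        Matrix.mul_apply, ← Fin.sum_univ_eq_sum_range
          (fun t => (a.choose (c - b + t) : ℤ) * (b.choose (c - (c - b + t)) : ℤ) *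
            (hahn μ a b c (c - b + t) * hahn ν a b c (c - b + t))) N]
      push_cast
      rw [Finset.sum_div]
      refine Finset.sum_congr rfl fun t _ => ?_
      simp only [P, Q, W]
      ring
    rw [h1]
    by_cases h : μ = ν
    · subst h
      rw [Matrix.one_apply_eq, div_self]
      have hμ := μ.2
      have := hahnInner_base_pos (m := (μ : ℕ)) (a := a) (b := b) (by omega) (by omega)
      have h3 : 0 < (a + b - 2 * (μ : ℕ)).choose (c - μ) := Nat.choose_pos (by omega)
      rw [hahnInner_self (by omega) (by omega)]
      exact_mod_cast (by positivity)
    · rw [Matrix.one_apply_ne h, hahnInner_eq_zero _ _ _ (fun h' => h (Fin.ext h'))]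
      simp
  -- Orthogonality of the rows gives a right inverse; for a square matrix it is also a left inverse,
  -- which is completeness. The coefficients wanted form the row of `Q` belonging to `x₀`.
  have hQP : Q * P = 1 := mul_eq_one_comm.1 hPQ
  refine ⟨fun μ => W x₀ * (hahn μ a b c x₀ : ℂ) / (hahnInner μ μ a b c : ℂ), fun x hx => ?_⟩
  rw [hIcc, Finset.mem_image] at hx hx₀
  obtain ⟨t, ht, rfl⟩ := hx
  obtain ⟨t₀, ht₀, rfl⟩ := hx₀
  rw [Finset.mem_range] at ht ht₀
  have := congrFun (congrFun hQP ⟨t₀, ht₀⟩) ⟨t, ht⟩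
  rw [Matrix.mul_apply, Matrix.one_apply] at this
  rw [← Fin.sum_univ_eq_sum_range (fun μ => W (c - b + t₀) * (hahn μ a b c (c - b + t₀) : ℂ) /
    (hahnInner μ μ a b c : ℂ) * (hahn μ a b c (c - b + t) : ℂ)) N]
  refine this.trans ?_
  simp [Fin.ext_iff, eq_comm]

/-! ### The Hahn factor of an internal vertex. -/

/-- With `w = x + j` the variable of a vertex runs over the support of the Hahn weight with `a = s'
- 2j`, `b = s - 2i`, `c = q - i - j`. -/
theorem varRange_eq_map {s s' q i j : ℕ} (hi : 2 * i ≤ s) (hj : 2 * j ≤ s') (hq : i + j ≤ q) :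
    varRange s s' q i j = (Finset.Icc (q - i - j - (s - 2 * i))
      (min (s' - 2 * j) (q - i - j))).map (addRightEmbedding j) := by
  rw [Finset.map_add_right_Icc, varRange]
  congr 1 <;> omega

/-- Orthogonality and norm of the factor of an internal vertex. -/
theorem sum_varRange_vertexHahn {s s' q i j k k' : ℕ} (hi : 2 * i ≤ s) (hj : 2 * j ≤ s')
    (hk : i + j ≤ k) (hk' : i + j ≤ k') (hkq : k ≤ q)
    (hks : 2 * k ≤ s + s') :
    ∑ w ∈ varRange s s' q i j, ((s - 2 * i).choose (q - w - i) : ℤ) *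
        ((s' - 2 * j).choose (w - j) : ℤ) *
        (vertexHahn s s' q k i j w * vertexHahn s s' q k' i j w) =
      if k = k' then ((s + s' - 2 * k).choose (q - k) : ℤ) *
        hahnInner (k - i - j) (k - i - j) (s' - 2 * j) (s - 2 * i) (k - i - j) else 0 := by
  have h1 : ∑ w ∈ varRange s s' q i j, ((s - 2 * i).choose (q - w - i) : ℤ) *
        ((s' - 2 * j).choose (w - j) : ℤ) *
        (vertexHahn s s' q k i j w * vertexHahn s s' q k' i j w) =
      hahnInner (k - i - j) (k' - i - j) (s' - 2 * j) (s - 2 * i) (q - i - j) := by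
    rw [varRange_eq_map hi hj (by omega), Finset.sum_map, hahnInner_eq_sum_Icc]
    refine Finset.sum_congr rfl fun x hx => ?_
    simp only [vertexHahn, addRightEmbedding_apply, Nat.add_sub_cancel]
    rw [show q - (x + j) - i = q - i - j - x by omega]
    ring
  rw [h1]
  split_ifs with h
  · subst h
    rw [hahnInner_self (by omega) (by omega)]
    congr 3 <;> omega
  · exact hahnInner_eq_zero _ _ _ (by omega)

/-- The factors of an internal vertex span the functions of its variable. -/
theorem exists_vertexHahn_expansion {s s' q i j w₀ : ℕ} (hi : 2 * i ≤ s) (hj : 2 * j ≤ s')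
    (hq : i + j ≤ q) (hq' : q + i + j ≤ s + s') (hw : w₀ ∈ varRange s s' q i j) :
    ∃ d : ℕ → ℂ, ∀ w ∈ varRange s s' q i j,
      ∑ μ ∈ Finset.range (min (min (s' - 2 * j) (s - 2 * i))
          (min (q - i - j) (s + s' - i - j - q)) + 1),
        d μ * (vertexHahn s s' q (μ + i + j) i j w : ℂ) = if w = w₀ then 1 else 0 := by
  rw [varRange_eq_map hi hj hq] at hw ⊢
  obtain ⟨x₀, hx₀, rfl⟩ := Finset.mem_map.1 hw
  obtain ⟨d, hd⟩ := exists_hahn_expansion (by omega) hx₀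
  refine ⟨d, fun w hw => ?_⟩
  obtain ⟨x, hx, rfl⟩ := Finset.mem_map.1 hw
  have := hd x hx
  rw [show s' - 2 * j + (s - 2 * i) - (q - i - j) = s + s' - i - j - q by omega] at this
  simp only [vertexHahn, addRightEmbedding_apply, Nat.add_sub_cancel, Nat.add_right_cancel_iff]
  rw [← this]
  refine Finset.sum_congr rfl fun μ _ => ?_
  rw [show μ + i + j - i - j = μ by omega]

/-! ### Functions on subsets attached to a labeled tree: expansion, norms, spanning. -/

section TreeFunctions

variable {n : ℕ}

theorem sum_leaves_node {M : Type} [AddCommMonoid M] {l r : PTree}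
    (a : Fin (PTree.node l r).leaves → M) :
    ∑ p, a p = ∑ p, leftPart a p + ∑ p, rightPart a p :=
  Fin.sum_univ_add (a : Fin (l.leaves + r.leaves) → M)

theorem forall_leaves_node {l r : PTree} {P : Fin (PTree.node l r).leaves → Prop} :
    (∀ p, P p) ↔ (∀ p, P (Fin.castAdd r.leaves p)) ∧ ∀ p, P (Fin.natAdd l.leaves p) :=
  ⟨fun h => ⟨fun _ => h _, fun _ => h _⟩, fun h p => Fin.addCases h.1 h.2 p⟩

theorem forall_leaves_leaf {P : Fin PTree.leaf.leaves → Prop} :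
    (∀ p, P p) ↔ P (0 : Fin 1) :=
  ⟨fun h => h _, fun h p => by rwa [show p = (0 : Fin 1) from Subsingleton.elim (α := Fin 1) _ _]⟩

theorem sum_leaves_leaf {M : Type} [AddCommMonoid M] (a : Fin PTree.leaf.leaves → M) :
    ∑ p, a p = a (0 : Fin 1) :=
  Fin.sum_univ_one (a : Fin 1 → M)

/-- The union of the blocks. -/
abbrev blockUnion {h : ℕ} (A : Fin h → Finset (Fin n)) : Finset (Fin n) :=
  Finset.univ.biUnion A

theorem blockUnion_node {l r : PTree} (A : Fin (PTree.node l r).leaves → Finset (Fin n)) :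
    blockUnion A = blockUnion (leftPart A) ∪ blockUnion (rightPart A) := by
  ext x
  simp only [Finset.mem_biUnion, Finset.mem_univ, true_and, Finset.mem_union]
  rw [← not_iff_not]
  push Not
  exact forall_leaves_node

theorem blockUnion_leaf (A : Fin PTree.leaf.leaves → Finset (Fin n)) :
    blockUnion A = A (0 : Fin 1) := by
  ext x
  simp only [Finset.mem_biUnion, Finset.mem_univ, true_and]
  rw [← not_iff_not]
  push Not
  exact forall_leaves_leaf

/-- Blocks that are pairwise disjoint. -/
def DisjointBlocks {h : ℕ} (A : Fin h → Finset (Fin n)) : Prop :=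
  ∀ i j, i ≠ j → Disjoint (A i) (A j)

theorem DisjointBlocks.left {l r : PTree} {A : Fin (PTree.node l r).leaves → Finset (Fin n)}
    (hA : DisjointBlocks A) : DisjointBlocks (leftPart A) := fun _ _ hij =>
  hA _ _ fun h => hij (Fin.castAdd_injective _ _ h)

theorem DisjointBlocks.right {l r : PTree} {A : Fin (PTree.node l r).leaves → Finset (Fin n)}
    (hA : DisjointBlocks A) : DisjointBlocks (rightPart A) := fun _ _ hij =>
  hA _ _ fun h => hij (Fin.natAdd_injective _ _ h)

theorem DisjointBlocks.disjoint_unions {l r : PTree}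
    {A : Fin (PTree.node l r).leaves → Finset (Fin n)} (hA : DisjointBlocks A) :
    Disjoint (blockUnion (leftPart A)) (blockUnion (rightPart A)) := by
  simp only [Finset.disjoint_biUnion_left, Finset.disjoint_biUnion_right]
  intro j _ i _
  refine hA _ _ fun h => ?_
  have h1 : (Fin.castAdd r.leaves i : Fin (l.leaves + r.leaves)).val =
    (Fin.natAdd l.leaves j).val := congrArg Fin.val h
  simp only [Fin.val_castAdd, Fin.val_natAdd] at h1
  omega

/-- The characteristic function of the subsets of the union of the blocks that have `x j`
elements in the block `A j`. -/
noncomputable def blockChar {h : ℕ} (A : Fin h → Finset (Fin n)) (x : Fin h → ℕ) :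
    Finset (Fin n) → ℂ :=
  fun Z => if Z ⊆ blockUnion A ∧ ∀ j, (Z ∩ A j).card = x j then 1 else 0

theorem sigma_eq_blockChar (q : ℕ) (A : Fin PTree.leaf.leaves → Finset (Fin n))
    (x : Fin PTree.leaf.leaves → ℕ) (hx : x (0 : Fin 1) = q) :
    sigma q (A (0 : Fin 1)) = blockChar A x := by
  funext Z
  simp only [sigma, blockChar, blockUnion_leaf]
  refine if_congr (and_congr_right fun hZ => ?_) rfl rfl
  rw [forall_leaves_leaf, hx, Finset.inter_eq_left.2 hZ]

theorem tensor_blockChar {l r : PTree} (A : Fin (PTree.node l r).leaves → Finset (Fin n))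
    (x : Fin (PTree.node l r).leaves → ℕ) :
    tensor (blockUnion (leftPart A)) (blockUnion (rightPart A))
      (blockChar (leftPart A) (leftPart x)) (blockChar (rightPart A) (rightPart x)) =
    blockChar A x := by
  funext Z
  simp only [tensor, blockChar, ← ite_and, mul_ite, mul_one, mul_zero, blockUnion_node A]
  refine if_congr (and_congr_right fun _ => ?_) rfl rfl
  rw [forall_leaves_node, and_comm]
  refine and_congr ?_ ?_
  · simp only [Finset.inter_subset_right, true_and]
    refine forall_congr' fun j => ?_
    rw [Finset.inter_assoc, Finset.inter_eq_right.2
      (Finset.subset_biUnion_of_mem (leftPart A) (Finset.mem_univ j))]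
    rfl
  · simp only [Finset.inter_subset_right, true_and]
    refine forall_congr' fun j => ?_
    rw [Finset.inter_assoc, Finset.inter_eq_right.2
      (Finset.subset_biUnion_of_mem (rightPart A) (Finset.mem_univ j))]
    rfl

/-- The tensor product as a bilinear map. -/
noncomputable def tensorₗ (X X' : Finset (Fin n)) :
    (Finset (Fin n) → ℂ) →ₗ[ℂ] (Finset (Fin n) → ℂ) →ₗ[ℂ] (Finset (Fin n) → ℂ) :=
  LinearMap.mk₂ ℂ (tensor X X')
    (fun f f' g => by funext Z; simp only [tensor, Pi.add_apply]; split_ifs <;> ring)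
    (fun c f g => by
      funext Z; simp only [tensor, Pi.smul_apply, smul_eq_mul]; split_ifs <;> ring)
    (fun f g g' => by funext Z; simp only [tensor, Pi.add_apply]; split_ifs <;> ring)
    (fun c f g => by
      funext Z; simp only [tensor, Pi.smul_apply, smul_eq_mul]; split_ifs <;> ring)

theorem tensorₗ_apply (X X' : Finset (Fin n)) (f g : Finset (Fin n) → ℂ) :
    tensorₗ X X' f g = tensor X X' f g := rfl

/-- The expansion of `Φ` in characteristic functions. -/
theorem phiAux_eq_sum : (T : PTree) → (a : Fin T.leaves → ℕ) →
    (A : Fin T.leaves → Finset (Fin n)) → (q : ℕ) → (k : Labeling T) →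
    phiAux T a A q k = ∑ w ∈ varLabelings T a q k,
      (multiHahn T a q k w : ℂ) • blockChar A (leafCounts T q w)
  | .leaf, a, A, q, k => by
    change sigma q (A (0 : Fin 1)) = ∑ w ∈ ({()} : Finset Unit), ((1 : ℤ) : ℂ) •
      blockChar A fun _ => q
    rw [Finset.sum_singleton, Int.cast_one, one_smul]
    exact sigma_eq_blockChar q A _ rfl
  | .node l r, a, A, q, k => by
    rw [phiAux, varLabelings]
    refine Eq.trans ?_ (Finset.sum_biUnion (s := varRange (∑ p, leftPart a p)
      (∑ p, rightPart a p) q (repLabel l k.left) (repLabel r k.right)) (M := Finset (Fin n) → ℂ)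
      (f := fun w : ℕ × Labeling l × Labeling r =>
        (multiHahn (.node l r) a q k w : ℂ) • blockChar A (leafCounts (.node l r) q w)) ?_).symm
    · refine Finset.sum_congr rfl fun w _ => ?_
      rw [Finset.sum_product, Finset.sum_singleton, Finset.sum_product,
        phiAux_eq_sum l, phiAux_eq_sum r, ← tensorₗ_apply]
      simp only [map_sum, map_smul, LinearMap.sum_apply, LinearMap.smul_apply, Finset.smul_sum,
        smul_smul]
      rw [Finset.sum_comm]
      refine Finset.sum_congr rfl fun u _ => Finset.sum_congr rfl fun v _ => ?_
      rw [tensorₗ_apply]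
      have h := tensor_blockChar A (leafCounts (.node l r) q (w, u, v))
      have hl : leftPart (leafCounts (.node l r) q (w, u, v)) = leafCounts l (q - w) u :=
        funext fun j => Fin.append_left _ _ j
      have hr : rightPart (leafCounts (.node l r) q (w, u, v)) = leafCounts r w v :=
        funext fun j => Fin.append_right _ _ j
      rw [hl, hr] at h
      rw [h]
      congr 1
      simp only [multiHahn]
      push_cast
      change _ = (vertexHahn _ _ q _ _ _ w : ℂ) * (multiHahn l _ (q - w) _ u : ℂ) *
        (multiHahn r _ w _ v : ℂ)
      ring
    · intro w _ w' _ hne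
      refine Finset.disjoint_left.2 fun x hx hx' => hne ?_
      simp only [Finset.mem_product, Finset.mem_singleton] at hx hx'
      exact hx.1.symm.trans hx'.1

/-- Used for orthogonality: functions with different space labels live on subsets of different
cardinalities. -/
theorem phiAux_support : (T : PTree) → (a : Fin T.leaves → ℕ) →
    (A : Fin T.leaves → Finset (Fin n)) → DisjointBlocks A → (q : ℕ) → (k : Labeling T) →
    (Z : Finset (Fin n)) → phiAux T a A q k Z ≠ 0 → Z ⊆ blockUnion A ∧ Z.card = q
  | .leaf, a, A, hA, q, k, Z, h => by
    rw [blockUnion_leaf]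
    by_contra h'
    exact h (if_neg h')
  | .node l r, a, A, hA, q, k, Z, h => by
    rw [phiAux, Finset.sum_apply] at h
    obtain ⟨w, hw, h⟩ := Finset.exists_ne_zero_of_sum_ne_zero h
    rw [Pi.smul_apply, smul_eq_mul] at h
    have h := right_ne_zero_of_mul h
    rw [tensor] at h
    split_ifs at h with hZ
    · obtain ⟨-, hl⟩ := phiAux_support l _ _ hA.left _ _ _ (left_ne_zero_of_mul h)
      obtain ⟨-, hr⟩ := phiAux_support r _ _ hA.right _ _ _ (right_ne_zero_of_mul h)
      refine ⟨by rwa [blockUnion_node], ?_⟩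
      have hZ' : Z = (Z ∩ blockUnion (leftPart A)) ∪ (Z ∩ blockUnion (rightPart A)) := by
        rw [← Finset.inter_union_distrib_left, Finset.inter_eq_left.2 hZ]
      rw [hZ', Finset.card_union_of_disjoint, hl, hr]
      · simp only [varRange, Finset.mem_Icc] at hw
        omega
      · exact hA.disjoint_unions.mono Finset.inter_subset_right Finset.inter_subset_right
    · exact absurd rfl h

/-- The scalar product of functions on all subsets. -/
noncomputable def subsetInner (f g : Finset (Fin n) → ℂ) : ℂ :=
  ∑ Z, star (f Z) * g Z

theorem subsetInner_sum_smul {ι κ : Type} (s : Finset ι) (t : Finset κ) (c : ι → ℂ) (d : κ → ℂ)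
    (f : ι → Finset (Fin n) → ℂ) (g : κ → Finset (Fin n) → ℂ) :
    subsetInner (∑ i ∈ s, c i • f i) (∑ j ∈ t, d j • g j) =
      ∑ i ∈ s, ∑ j ∈ t, star (c i) * d j * subsetInner (f i) (g j) := by
  simp only [subsetInner, Finset.sum_apply, Pi.smul_apply, smul_eq_mul, star_sum, star_mul',
    Finset.sum_mul_sum]
  rw [Finset.sum_comm]
  refine Finset.sum_congr rfl fun i _ => ?_
  rw [Finset.sum_comm]
  refine Finset.sum_congr rfl fun j _ => ?_
  rw [Finset.mul_sum]
  exact Finset.sum_congr rfl fun Z _ => by ring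

/-- Subsets of a disjoint union are pairs of subsets, so the sum factors. A support condition on one
function of each pair suffices, since only products enter. -/
theorem subsetInner_tensor {X X' : Finset (Fin n)} (hX : Disjoint X X')
    {f f' g g' : Finset (Fin n) → ℂ} (hf : ∀ Z, f' Z ≠ 0 → Z ⊆ X) (hg : ∀ Z, g' Z ≠ 0 → Z ⊆ X') :
    subsetInner (tensor X X' f g) (tensor X X' f' g') = subsetInner f f' * subsetInner g g' := by
  have h1 : subsetInner (tensor X X' f g) (tensor X X' f' g') =
      ∑ Z ∈ (X ∪ X').powerset, star (f (Z ∩ X) * g (Z ∩ X')) * (f' (Z ∩ X) * g' (Z ∩ X')) := by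
    rw [subsetInner, ← Finset.sum_subset (Finset.subset_univ (X ∪ X').powerset)]
    · refine Finset.sum_congr rfl fun Z hZ => ?_
      simp only [tensor, if_pos (Finset.mem_powerset.1 hZ)]
    · intro Z _ hZ
      simp only [tensor, if_neg (fun h => hZ (Finset.mem_powerset.2 h)), mul_zero]
  have h2 : ∀ {X : Finset (Fin n)} {f f' : Finset (Fin n) → ℂ}, (∀ Z, f' Z ≠ 0 → Z ⊆ X) →
      subsetInner f f' = ∑ Z ∈ X.powerset, star (f Z) * f' Z := by
    intro X f f' hf
    rw [subsetInner, ← Finset.sum_subset (Finset.subset_univ X.powerset)]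
    intro Z _ hZ
    have : f' Z = 0 := by
      by_contra h
      exact hZ (Finset.mem_powerset.2 (hf Z h))
    rw [this, mul_zero]
  rw [h1, h2 hf, h2 hg, Finset.sum_mul_sum, ← Finset.sum_product']
  refine Finset.sum_bij' (fun Z _ => (Z ∩ X, Z ∩ X')) (fun p _ => p.1 ∪ p.2) ?_ ?_ ?_ ?_ ?_
  · intro Z _
    simp
  · rintro ⟨U, V⟩ h
    simp only [Finset.mem_product, Finset.mem_powerset] at h ⊢
    exact Finset.union_subset_union h.1 h.2
  · intro Z hZ
    rw [← Finset.inter_union_distrib_left, Finset.inter_eq_left.2 (Finset.mem_powerset.1 hZ)]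
  · rintro ⟨U, V⟩ h
    simp only [Finset.mem_product, Finset.mem_powerset] at h
    simp only [Finset.union_inter_distrib_right, Finset.inter_eq_left.2 h.1,
      Finset.inter_eq_left.2 h.2,
      Finset.disjoint_iff_inter_eq_empty.1 (hX.mono_left h.1),
      Finset.disjoint_iff_inter_eq_empty.1 (hX.symm.mono_left h.2), Finset.union_empty,
      Finset.empty_union]
  · intro Z _
    simp only [star_mul']
    ring

/-- The part of the norm of `Φ` that does not depend on the space label of the root. -/
def treeNorm : (T : PTree) → (Fin T.leaves → ℕ) → Labeling T → ℤ
  | .leaf, _, _ => 1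
  | .node l r, a, k =>
      treeNorm l (leftPart a) k.left * treeNorm r (rightPart a) k.right *
        hahnInner (k.root - repLabel l k.left - repLabel r k.right)
          (k.root - repLabel l k.left - repLabel r k.right)
          (∑ p, rightPart a p - 2 * repLabel r k.right) (∑ p, leftPart a p - 2 * repLabel l k.left)
          (k.root - repLabel l k.left - repLabel r k.right)

/-- The conditions on a labeling say precisely that the degree `k - i - j` is at most `s - 2i` and
`s' - 2j`, as `hahnInner_base_pos` requires. -/
theorem treeNorm_pos : (T : PTree) → (a : Fin T.leaves → ℕ) → (k : Labeling T) →
    RepCond T a k → 0 < treeNorm T a k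
  | .leaf, _, _, _ => one_pos
  | .node l r, a, k, hk => by
    obtain ⟨h1, h2, h3, h4, h5, hl, hr⟩ := hk
    exact mul_pos (mul_pos (treeNorm_pos l _ _ hl) (treeNorm_pos r _ _ hr))
      (hahnInner_base_pos (by omega) (by omega))

theorem repLabel_node {l r : PTree} (k : Labeling (.node l r)) :
    repLabel (.node l r) k = k.root := rfl

/-- The labeling with a given label of the root and given labelings of the subtrees. -/
def Labeling.node {l r : PTree} (κ : ℕ) (k : Labeling l) (k' : Labeling r) :
    Labeling (.node l r) := (κ, k, k')

theorem Labeling.root_node {l r : PTree} (κ : ℕ) (k : Labeling l) (k' : Labeling r) :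
    (Labeling.node κ k k').root = κ := rfl

theorem Labeling.left_node {l r : PTree} (κ : ℕ) (k : Labeling l) (k' : Labeling r) :
    (Labeling.node κ k k').left = k := rfl

theorem Labeling.right_node {l r : PTree} (κ : ℕ) (k : Labeling l) (k' : Labeling r) :
    (Labeling.node κ k k').right = k' := rfl

theorem phiAux_node {l r : PTree} (a : Fin (PTree.node l r).leaves → ℕ)
    (A : Fin (PTree.node l r).leaves → Finset (Fin n)) (q κ : ℕ) (k : Labeling l)
    (k' : Labeling r) :
    phiAux (.node l r) a A q (.node κ k k') =
      ∑ w ∈ varRange (∑ p, leftPart a p) (∑ p, rightPart a p) q (repLabel l k) (repLabel r k'),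
        (vertexHahn (∑ p, leftPart a p) (∑ p, rightPart a p) q κ (repLabel l k)
          (repLabel r k') w : ℂ) •
        tensor (blockUnion (leftPart A)) (blockUnion (rightPart A))
          (phiAux l (leftPart a) (leftPart A) (q - w) k)
          (phiAux r (rightPart a) (rightPart A) w k') := rfl

theorem Labeling.ext_node {l r : PTree} {k k' : Labeling (.node l r)} (h : k.root = k'.root)
    (hl : k.left = k'.left) (hr : k.right = k'.right) : k = k' :=
  Prod.ext h (Prod.ext hl hr)

/-- Orthogonality and norms of the functions `Φ`. -/
theorem subsetInner_phiAux : (T : PTree) → (a : Fin T.leaves → ℕ) →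
    (A : Fin T.leaves → Finset (Fin n)) → DisjointBlocks A → (∀ j, (A j).card = a j) → (q : ℕ) →
    (k k' : Labeling T) → RepCond T a k → RepCond T a k' →
    repLabel T k ≤ q → q + repLabel T k ≤ ∑ p, a p →
    repLabel T k' ≤ q → q + repLabel T k' ≤ ∑ p, a p →
    subsetInner (phiAux T a A q k) (phiAux T a A q k') =
      if k = k' then
        ((((∑ p, a p - 2 * repLabel T k).choose (q - repLabel T k) : ℤ) * treeNorm T a k : ℤ) : ℂ)
      else 0
  | .leaf, a, A, hA, hcard, q, k, k', _, _, _, _, _, _ => by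
    rw [if_pos (show k = k' from Subsingleton.elim (α := Unit) k k')]
    simp only [phiAux, subsetInner, repLabel, treeNorm, sum_leaves_leaf]
    have : ∀ Z, star (sigma q (A (0 : Fin 1)) Z) * sigma q (A (0 : Fin 1)) Z =
        if Z ∈ (A (0 : Fin 1)).powersetCard q then 1 else 0 := by
      intro Z
      simp only [sigma, Finset.mem_powersetCard]
      split_ifs <;> simp
    rw [Finset.sum_congr rfl fun Z _ => this Z, Finset.sum_ite_mem, Finset.univ_inter]
    simp only [Finset.sum_const, Finset.card_powersetCard]
    simpa using congrArg (fun t => (Nat.choose t q : ℂ)) (hcard (0 : Fin 1))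
  | .node l r, a, A, hA, hcard, q, k, k', hk, hk', h1, h2, h1', h2' => by
    have hcl : ∀ j, (leftPart A j).card = leftPart a j := fun j => hcard _
    have hcr : ∀ j, (rightPart A j).card = rightPart a j := fun j => hcard _
    obtain ⟨c1, c2, c3, c4, c5, hl, hr⟩ := hk
    obtain ⟨c1', c2', c3', c4', c5', hl', hr'⟩ := hk'
    simp only [phiAux, subsetInner_sum_smul]
    rw [sum_leaves_node] at h2 h2' ⊢
    simp only [repLabel_node] at h1 h1' h2 h2' ⊢
    generalize hs : ∑ p, leftPart a p = s at *
    generalize hs' : ∑ p, rightPart a p = s' at *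
    have ht : ∀ w w', subsetInner
        (tensor (blockUnion (leftPart A)) (blockUnion (rightPart A))
          (phiAux l (leftPart a) (leftPart A) (q - w) k.left)
          (phiAux r (rightPart a) (rightPart A) w k.right))
        (tensor (blockUnion (leftPart A)) (blockUnion (rightPart A))
          (phiAux l (leftPart a) (leftPart A) (q - w') k'.left)
          (phiAux r (rightPart a) (rightPart A) w' k'.right)) =
        subsetInner (phiAux l (leftPart a) (leftPart A) (q - w) k.left)
          (phiAux l (leftPart a) (leftPart A) (q - w') k'.left) *
        subsetInner (phiAux r (rightPart a) (rightPart A) w k.right)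
          (phiAux r (rightPart a) (rightPart A) w' k'.right) := fun w w' =>
      subsetInner_tensor hA.disjoint_unions
        (fun Z h => (phiAux_support l _ _ hA.left _ _ Z h).1)
        (fun Z h => (phiAux_support r _ _ hA.right _ _ Z h).1)
    have hne : ∀ w w', w ≠ w' → subsetInner (phiAux r (rightPart a) (rightPart A) w k.right)
          (phiAux r (rightPart a) (rightPart A) w' k'.right) = 0 := by
      intro w w' hww
      refine Finset.sum_eq_zero fun Z _ => ?_
      by_contra h
      have e1 := (phiAux_support r _ _ hA.right _ _ Z (right_ne_zero_of_mul h)).2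
      have e2 := (phiAux_support r _ _ hA.right _ _ Z
        (fun h0 => left_ne_zero_of_mul h (by rw [h0, star_zero]))).2
      exact hww (e2.symm.trans e1)
    simp only [ht]
    -- The range of `w` is exactly what lets the induction hypothesis apply to both subtrees, with
    -- space labels `q - w` and `w`.
    have hmem : ∀ w (k : Labeling (.node l r)),
        w ∈ varRange s s' q (repLabel l k.left) (repLabel r k.right) →
        repLabel l k.left + repLabel r k.right ≤ k.root →
        k.root ≤ q → q + k.root ≤ s + s' →
        2 * repLabel r k.right ≤ s' →
        repLabel l k.left ≤ q - w ∧ q - w + repLabel l k.left ≤ s ∧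
        repLabel r k.right ≤ w ∧ w + repLabel r k.right ≤ s' := by
      intro w k hw _ _ _ _
      simp only [varRange, Finset.mem_Icc] at hw
      omega
    by_cases hsub : k.left = k'.left ∧ k.right = k'.right
    · obtain ⟨el, er⟩ := hsub
      -- Cardinality leaves only `w' = w`. By induction the subtree norms are the Hahn weight at `w`
      -- times constants that do not depend on `w`.
      have key : ∀ w ∈ varRange s s' q (repLabel l k.left) (repLabel r k.right),
          ∑ w' ∈ varRange s s' q (repLabel l k'.left) (repLabel r k'.right),
            star (vertexHahn s s' q k.root (repLabel l k.left) (repLabel r k.right) w : ℂ) *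
              (vertexHahn s s' q k'.root (repLabel l k'.left) (repLabel r k'.right) w' : ℂ) *
              (subsetInner (phiAux l (leftPart a) (leftPart A) (q - w) k.left)
                (phiAux l (leftPart a) (leftPart A) (q - w') k'.left) *
              subsetInner (phiAux r (rightPart a) (rightPart A) w k.right)
                (phiAux r (rightPart a) (rightPart A) w' k'.right)) =
          (((s - 2 * repLabel l k.left).choose (q - w - repLabel l k.left) : ℤ) *
            ((s' - 2 * repLabel r k.right).choose (w - repLabel r k.right) : ℤ) *
            (vertexHahn s s' q k.root (repLabel l k.left) (repLabel r k.right) w *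
              vertexHahn s s' q k'.root (repLabel l k.left) (repLabel r k.right) w) : ℤ) *
            ((treeNorm l (leftPart a) k.left * treeNorm r (rightPart a) k.right : ℤ) : ℂ) := by
        intro w hw
        obtain ⟨m1, m2, m3, m4⟩ := hmem w k hw c5 h1 (by omega) c2
        rw [← el, ← er, Finset.sum_eq_single_of_mem w hw
          (fun w' _ hw' => by
            have h0 := hne w w' hw'.symm
            rw [← er] at h0
            rw [h0, mul_zero, mul_zero])]
        have il := subsetInner_phiAux l (leftPart a) (leftPart A) hA.left hcl (q - w)
          k.left k.left hl hl m1 (by omega) m1 (by omega)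
        have ir := subsetInner_phiAux r (rightPart a) (rightPart A) hA.right hcr w
          k.right k.right hr hr m3 (by omega) m3 (by omega)
        rw [if_pos rfl, hs] at il
        rw [if_pos rfl, hs'] at ir
        rw [il, ir]
        simp only [star_intCast]
        push_cast
        ring
      rw [Finset.sum_congr rfl key, ← Finset.sum_mul, ← Int.cast_sum,
        sum_varRange_vertexHahn c1 c2 c5 (by rw [el, er]; exact c5') h1 (by omega)]
      by_cases hroot : k.root = k'.root
      · rw [if_pos hroot, if_pos (Labeling.ext_node hroot el er)]
        simp only [treeNorm, hs, hs']
        push_cast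
        ring
      · rw [if_neg hroot, if_neg (fun h => hroot (by rw [h]))]
        simp
    · rw [if_neg (fun h => hsub (by rw [h]; exact ⟨rfl, rfl⟩))]
      -- Different subtree labelings: for `w = w'` one factor vanishes by induction, for `w ≠ w'` by
      -- cardinality.
      refine Finset.sum_eq_zero fun w hw => Finset.sum_eq_zero fun w' hw' => ?_
      obtain ⟨m1, m2, m3, m4⟩ := hmem w k hw c5 h1 (by omega) c2
      obtain ⟨m1', m2', m3', m4'⟩ := hmem w' k' hw' c5' h1' (by omega) c2'
      by_cases hww : w = w'
      · subst hww
        rw [subsetInner_phiAux l (leftPart a) (leftPart A) hA.left hcl (q - w)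
            k.left k'.left hl hl' m1 (by omega) m1' (by omega),
          subsetInner_phiAux r (rightPart a) (rightPart A) hA.right hcr w
            k.right k'.right hr hr' m3 (by omega) m3' (by omega)]
        rcases not_and_or.1 hsub with h | h
        · rw [if_neg h, zero_mul, mul_zero]
        · rw [if_neg h, mul_zero, mul_zero]
      · rw [hne w w' hww, mul_zero, mul_zero]

/-- The functions `Φ` span the functions of the numbers of elements in the blocks. -/
theorem blockChar_mem_span : (T : PTree) → (a : Fin T.leaves → ℕ) →
    (A : Fin T.leaves → Finset (Fin n)) → (x : Fin T.leaves → ℕ) → (∀ j, x j ≤ a j) →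
    blockChar A x ∈ Submodule.span ℂ {f | ∃ k, RepCond T a k ∧ repLabel T k ≤ ∑ p, x p ∧
      ∑ p, x p + repLabel T k ≤ ∑ p, a p ∧ f = phiAux T a A (∑ p, x p) k}
  | .leaf, a, A, x, hx => by
    refine Submodule.subset_span ⟨(), trivial, Nat.zero_le _, ?_, ?_⟩
    · change ∑ p, x p + 0 ≤ ∑ p, a p
      rw [add_zero]
      exact Finset.sum_le_sum fun j _ => hx j
    · exact (sigma_eq_blockChar _ A x (sum_leaves_leaf x).symm).symm
  | .node l r, a, A, x, hx => by
    rw [← tensor_blockChar, ← tensorₗ_apply]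
    refine Submodule.span_induction₂ (p := fun f g _ _ => tensorₗ (blockUnion (leftPart A))
        (blockUnion (rightPart A)) f g ∈ _) ?_ ?_ ?_ ?_ ?_ ?_ ?_
      (blockChar_mem_span l (leftPart a) (leftPart A) (leftPart x) fun j => hx _)
      (blockChar_mem_span r (rightPart a) (rightPart A) (rightPart x) fun j => hx _)
    · rintro _ _ ⟨k, hk, k1, k2, rfl⟩ ⟨k', hk', k1', k2', rfl⟩
      rw [sum_leaves_node x, sum_leaves_node a]
      generalize hu : ∑ p, leftPart x p = u at *
      generalize hv : ∑ p, rightPart x p = v at *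
      generalize hs : ∑ p, leftPart a p = s at *
      generalize hs' : ∑ p, rightPart a p = s' at *
      have hv : v ∈ varRange s s' (u + v) (repLabel l k) (repLabel r k') := by
        simp only [varRange, Finset.mem_Icc]
        omega
      -- With the subtree labelings fixed, varying the root label gives combinations of the same
      -- tensors, indexed by `w`. The expansion inverts this system and isolates the single tensor
      -- with `w = v`.
      obtain ⟨d, hd⟩ := exists_vertexHahn_expansion (by omega) (by omega) (by omega)
        (by omega) hv
      have key : tensorₗ (blockUnion (leftPart A)) (blockUnion (rightPart A))
          (phiAux l (leftPart a) (leftPart A) u k) (phiAux r (rightPart a) (rightPart A) v k') =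
          ∑ μ ∈ Finset.range (min (min (s' - 2 * repLabel r k') (s - 2 * repLabel l k))
            (min (u + v - repLabel l k - repLabel r k')
              (s + s' - repLabel l k - repLabel r k' - (u + v))) + 1),
            d μ • phiAux (.node l r) a A (u + v)
              (.node (μ + repLabel l k + repLabel r k') k k') := by
        simp only [phiAux_node, Finset.smul_sum, smul_smul]
        rw [Finset.sum_comm]
        simp only [← Finset.sum_smul]
        rw [hs, hs', Finset.sum_congr rfl fun w hw => by rw [hd w hw]]
        simp only [ite_smul, one_smul, zero_smul]
        rw [Finset.sum_ite_eq' _ v, if_pos hv, Nat.add_sub_cancel]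
        rfl
      rw [key]
      -- The root label is `μ + i + j`; the four bounds on `μ` are the two inequalities relating the
      -- labels at the vertex and the two bounds by the space label.
      refine Submodule.sum_mem _ fun μ hμ => Submodule.smul_mem _ _ (Submodule.subset_span
        ⟨.node (μ + repLabel l k + repLabel r k') k k',
          ⟨?_, ?_, ?_, ?_, ?_, hk, hk'⟩, ?_, ?_, rfl⟩)
      all_goals
        rw [Finset.mem_range] at hμ
        simp only [Labeling.root_node, Labeling.left_node, Labeling.right_node, repLabel_node,
          hs, hs']
        omega
    · intro g _
      simp
    · intro f _
      simp
    · intro f f' g _ _ _ h h'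
      rw [map_add, LinearMap.add_apply]
      exact add_mem h h'
    · intro f g g' _ _ _ h h'
      rw [map_add]
      exact add_mem h h'
    · intro c f g _ _ h
      rw [map_smul, LinearMap.smul_apply]
      exact Submodule.smul_mem _ _ h
    · intro c f g _ _ h
      rw [map_smul]
      exact Submodule.smul_mem _ _ h

end TreeFunctions

/-! ### Inversion on the group as a duality between two transitive actions. -/

section ChangeOfVariable

/-- A group element that carries the base point to a given point. -/
noncomputable def carrier (G : Type) {X : Type} [Group G] [MulAction G X]
    [MulAction.IsPretransitive G X] (x₀ x : X) : G :=
  (MulAction.exists_smul_eq G x₀ x).choose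

theorem carrier_smul {G X : Type} [Group G] [MulAction G X] [MulAction.IsPretransitive G X]
    (x₀ x : X) : carrier G x₀ x • x₀ = x :=
  (MulAction.exists_smul_eq G x₀ x).choose_spec

variable {G X Y : Type} [Group G] [MulAction G X] [MulAction G Y] [Fintype Y]
  [MulAction.IsPretransitive G X]

/-- Two group elements carrying `x₀` to the same point differ by the stabilizer of `x₀`, under which
`η` is invariant. So the chosen `carrier` may be replaced by any `g`. -/
theorem apply_carrier_inv_smul {x₀ : X} (y₀ : Y) {η : EuclideanSpace ℂ Y}
    (hη : η ∈ invariantFns (MulAction.stabilizer G x₀)) (g : G) :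
    η ((carrier G x₀ (g • x₀))⁻¹ • y₀) = η (g⁻¹ • y₀) := by
  have h : (carrier G x₀ (g • x₀))⁻¹ * g ∈ MulAction.stabilizer G x₀ := by
    rw [MulAction.mem_stabilizer_iff, mul_smul, inv_smul_eq_iff, carrier_smul]
  rw [← hη _ h (g⁻¹ • y₀), smul_smul, mul_assoc, mul_inv_cancel, mul_one]

variable [Fintype X]

/-- The change of variable `g ↦ g⁻¹`. -/
noncomputable def sharpMap (x₀ : X) (y₀ : Y) :
    invariantFns (X := Y) (MulAction.stabilizer G x₀) →ₗ[ℂ]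
      invariantFns (X := X) (MulAction.stabilizer G y₀) where
  toFun η := ⟨WithLp.toLp 2 fun x => η.1 ((carrier G x₀ x)⁻¹ • y₀), fun g hg x => by
    obtain ⟨h, rfl⟩ := MulAction.exists_smul_eq G x₀ x
    simp only
    rw [smul_smul, apply_carrier_inv_smul y₀ η.2, apply_carrier_inv_smul y₀ η.2, mul_inv_rev,
      mul_smul, MulAction.mem_stabilizer_iff.1 (inv_mem hg)]⟩
  map_add' _ _ := rfl
  map_smul' _ _ := rfl

theorem sharpMap_apply (x₀ : X) (y₀ : Y)
    (η : invariantFns (X := Y) (MulAction.stabilizer G x₀)) (g : G) :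
    (sharpMap x₀ y₀ η).1 (g • x₀) = η.1 (g⁻¹ • y₀) :=
  apply_carrier_inv_smul y₀ η.2 g

variable [MulAction.IsPretransitive G Y]

theorem sharpMap_sharpMap (x₀ : X) (y₀ : Y)
    (η : invariantFns (X := Y) (MulAction.stabilizer G x₀)) :
    sharpMap y₀ x₀ (sharpMap x₀ y₀ η) = η := by
  refine Subtype.ext (PiLp.ext fun y => ?_)
  obtain ⟨g, rfl⟩ := MulAction.exists_smul_eq G y₀ y
  rw [sharpMap_apply, sharpMap_apply, inv_inv]

/-- The change of variable `g ↦ g⁻¹` as an isomorphism. -/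
noncomputable def sharpEquiv (x₀ : X) (y₀ : Y) :
    invariantFns (X := Y) (MulAction.stabilizer G x₀) ≃ₗ[ℂ]
      invariantFns (X := X) (MulAction.stabilizer G y₀) :=
  { sharpMap x₀ y₀ with
    invFun := sharpMap y₀ x₀
    left_inv := sharpMap_sharpMap x₀ y₀
    right_inv := sharpMap_sharpMap y₀ x₀ }

theorem sharpEquiv_apply (x₀ : X) (y₀ : Y)
    (η : invariantFns (X := Y) (MulAction.stabilizer G x₀)) (g : G) :
    (sharpEquiv x₀ y₀ η).1 (g • x₀) = η.1 (g⁻¹ • y₀) :=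
  sharpMap_apply x₀ y₀ η g

/-- Double counting of the sum of `F (g • x)` over `G × X`: the inner sum over `G` does not depend
on `x`, by transitivity, and the one over `X` does not depend on `g`. -/
theorem card_mul_sum_smul [Fintype G] (x₀ : X) (F : X → ℂ) :
    (Fintype.card X : ℂ) * ∑ g : G, F (g • x₀) = (Fintype.card G : ℂ) * ∑ x, F x := by
  have h1 : ∀ x : X, ∑ g : G, F (g • x) = ∑ g : G, F (g • x₀) := by
    intro x
    obtain ⟨h, rfl⟩ := MulAction.exists_smul_eq G x₀ x
    simp only [smul_smul]
    exact Fintype.sum_equiv (Equiv.mulRight h) _ _ fun g => rfl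
  have h2 : ∀ g : G, ∑ x, F (g • x) = ∑ x, F x := fun g =>
    Fintype.sum_equiv (MulAction.toPerm g) _ _ fun x => rfl
  calc _ = ∑ x : X, ∑ g : G, F (g • x) := by simp [h1]
    _ = ∑ g : G, ∑ x : X, F (g • x) := Finset.sum_comm
    _ = _ := by simp [h2]

/-- Lifted to `G`, the two scalar products are the same sum up to `g ↦ g⁻¹`; only the normalizations
by the sizes of the orbits differ. -/
theorem card_mul_inner_sharpEquiv [Finite G] (x₀ : X) (y₀ : Y)
    (η ξ : invariantFns (X := Y) (MulAction.stabilizer G x₀)) :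
    (Fintype.card Y : ℂ) * inner ℂ (sharpEquiv x₀ y₀ η).1 (sharpEquiv x₀ y₀ ξ).1 =
      (Fintype.card X : ℂ) * inner ℂ η.1 ξ.1 := by
  have := Fintype.ofFinite G
  have hG : (Fintype.card G : ℂ) ≠ 0 := by simp
  have h1 := card_mul_sum_smul (G := G) x₀ fun x =>
    inner ℂ ((sharpEquiv x₀ y₀ η).1 x) ((sharpEquiv x₀ y₀ ξ).1 x)
  have h2 := card_mul_sum_smul (G := G) y₀ fun y => inner ℂ (η.1 y) (ξ.1 y)
  simp only [sharpEquiv_apply] at h1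
  rw [← Equiv.sum_comp (Equiv.inv G)] at h2
  simp only [Equiv.inv_apply] at h2
  simp only [PiLp.inner_apply]
  refine mul_left_cancel₀ hG ?_
  linear_combination (Fintype.card X : ℂ) * h2 - (Fintype.card Y : ℂ) * h1

end ChangeOfVariable

/-! ### Orbits, stabilizers and invariants of ordered set partitions. -/

section Partitions

variable {n : ℕ}

/-- Two maps whose fibres have the same cardinalities differ by a permutation. -/
theorem exists_perm_of_card_fiber_eq {α ι : Type} [Fintype α] [DecidableEq ι] {f f' : α → ι}
    (h : ∀ i, Fintype.card {x // f x = i} = Fintype.card {x // f' x = i}) :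
    ∃ e : Equiv.Perm α, ∀ x, f' (e x) = f x :=
  ⟨Equiv.ofFiberEquiv fun i => Fintype.equivOfCardEq (h i), fun x => Equiv.ofFiberEquiv_map _ x⟩

theorem mem_perm_smul_finset {g : Equiv.Perm (Fin n)} {s : Finset (Fin n)} {x : Fin n} :
    g x ∈ g • s ↔ x ∈ s :=
  Finset.smul_mem_smul_finset_iff g

theorem card_smul_inter (g : Equiv.Perm (Fin n)) (s t : Finset (Fin n)) :
    (g • s ∩ g • t).card = (s ∩ t).card := by
  rw [← Finset.smul_finset_inter, Finset.card_smul_finset]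

theorem OmegaComp.blockUnion_eq_univ {h : ℕ} {a : Fin h → ℕ} (ha : ∑ j, a j = n)
    (B : OmegaComp n a) : blockUnion B.1 = Finset.univ := by
  rw [← Finset.card_eq_iff_eq_univ, Finset.card_biUnion fun i _ j _ hij => B.2.2 i j hij,
    Finset.sum_congr rfl fun j _ => B.2.1 j, ha, Fintype.card_fin]

/-- The map that sends a point to the index of its block. -/
theorem OmegaComp.exists_index {h : ℕ} {a : Fin h → ℕ} (ha : ∑ j, a j = n)
    (B : OmegaComp n a) : ∃ f : Fin n → Fin h, ∀ x j, f x = j ↔ x ∈ B.1 j := by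
  have h1 : ∀ x, ∃ j, x ∈ B.1 j := fun x => by
    have := Finset.mem_univ x
    rw [← B.blockUnion_eq_univ ha] at this
    simpa using this
  choose f hf using h1
  refine ⟨f, fun x j => ⟨fun h => h ▸ hf x, fun hx => ?_⟩⟩
  by_contra hne
  exact Finset.disjoint_left.1 (B.2.2 _ _ hne) (hf x) hx

theorem OmegaComp.smul_val {h : ℕ} {a : Fin h → ℕ} (g : Equiv.Perm (Fin n)) (B : OmegaComp n a)
    (j : Fin h) : (g • B).1 j = g • B.1 j := rfl

theorem OmegaComp.isPretransitive {h : ℕ} {a : Fin h → ℕ} (ha : ∑ j, a j = n) :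
    MulAction.IsPretransitive (Equiv.Perm (Fin n)) (OmegaComp n a) where
  exists_smul_eq B B' := by
    obtain ⟨f, hf⟩ := B.exists_index ha
    obtain ⟨f', hf'⟩ := B'.exists_index ha
    obtain ⟨e, he⟩ := exists_perm_of_card_fiber_eq (f := f) (f' := f') fun j => by
      simp only [hf, hf', Fintype.card_coe, B.2.1, B'.2.1]
    refine ⟨e, Subtype.ext (funext fun j => Finset.ext fun y => ?_)⟩
    obtain ⟨x, rfl⟩ := e.surjective y
    rw [OmegaComp.smul_val, mem_perm_smul_finset, ← hf, ← hf', he]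

/-- Orbit-stabilizer: fixing the partition means preserving the index function, and such
permutations permute each block independently. -/
theorem OmegaComp.card_mul {h : ℕ} {a : Fin h → ℕ} (ha : ∑ j, a j = n) :
    Fintype.card (OmegaComp n a) * ∏ j, (a j).factorial = n.factorial := by
  classical
  have := OmegaComp.isPretransitive (n := n) ha
  set B := basePartition a ha
  obtain ⟨f, hf⟩ := B.exists_index ha
  have h1 := MulAction.card_orbit_mul_card_stabilizer_eq_card_group (Equiv.Perm (Fin n)) B
  rw [Fintype.card_perm, Fintype.card_fin] at h1
  rw [← h1]
  congr 1
  · rw [← Fintype.card_congr (Equiv.Set.univ (OmegaComp n a))]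
    exact Fintype.card_congr (Equiv.setCongr (MulAction.orbit_eq_univ _ B).symm)
  · have h2 := DomMulAct.stabilizer_card f
    simp only [hf, Fintype.card_coe, B.2.1] at h2
    rw [← h2]
    refine Fintype.card_congr (Equiv.subtypeEquivRight fun g => ?_)
    rw [MulAction.mem_stabilizer_iff]
    constructor
    · intro hg
      refine Subtype.ext (funext fun j => Finset.ext fun y => ?_)
      obtain ⟨x, rfl⟩ := g.surjective y
      rw [OmegaComp.smul_val, mem_perm_smul_finset, ← hf, ← hf]
      exact iff_of_eq (congrArg (· = j) (congrFun hg x).symm)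
    · intro hg
      funext x
      rw [Function.comp_apply, hf, ← hg, OmegaComp.smul_val, mem_perm_smul_finset, ← hf]

theorem smul_block {h : ℕ} {a : Fin h → ℕ} (ha : ∑ j, a j = n) {g : Equiv.Perm (Fin n)}
    (hg : g ∈ MulAction.stabilizer (Equiv.Perm (Fin n)) (basePartition a ha)) (j : Fin h) :
    g • block n a j = block n a j :=
  congrFun (congrArg Subtype.val (MulAction.mem_stabilizer_iff.1 hg)) j

theorem sigmaBlocks_mem_invariantFns {h : ℕ} {a : Fin h → ℕ} (ha : ∑ j, a j = n) (m : ℕ)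
    (x : Fin h → ℕ) : sigmaBlocks n a m x ∈
      invariantFns (MulAction.stabilizer (Equiv.Perm (Fin n)) (basePartition a ha)) := by
  intro g hg Z
  refine if_congr (forall_congr' fun j => ?_) rfl rfl
  rw [← smul_block ha hg j]
  change (g • Z.1 ∩ g • block n a j).card = x j ↔ (Z.1 ∩ g • block n a j).card = x j
  rw [card_smul_inter, smul_block ha hg j]

/-- The numbers of elements in the blocks. -/
def blockCounts {h : ℕ} (a : Fin h → ℕ) (Z : Finset (Fin n)) : Fin h → ℕ :=
  fun j => (Z ∩ block n a j).card

theorem sum_blockCounts {h : ℕ} {a : Fin h → ℕ} (ha : ∑ j, a j = n) (Z : Finset (Fin n)) :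
    ∑ j, blockCounts a Z j = Z.card := by
  have h1 := (basePartition a ha).blockUnion_eq_univ ha
  conv_rhs => rw [← Finset.inter_univ Z, ← h1, blockUnion, Finset.inter_biUnion]
  rw [Finset.card_biUnion]
  · rfl
  · intro i _ j _ hij
    exact (disjoint_block a hij).mono Finset.inter_subset_right Finset.inter_subset_right

/-- Subsets with the same numbers of elements in the blocks are in the same orbit. -/
theorem exists_smul_eq_of_blockCounts_eq {h : ℕ} {a : Fin h → ℕ} (ha : ∑ j, a j = n)
    {Z Z' : Finset (Fin n)} (hZ : blockCounts a Z = blockCounts a Z') :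
    ∃ g ∈ MulAction.stabilizer (Equiv.Perm (Fin n)) (basePartition a ha), g • Z = Z' := by
  obtain ⟨f, hf⟩ := (basePartition a ha).exists_index ha
  change ∀ x j, f x = j ↔ x ∈ block n a j at hf
  -- Colour each point by its block and by membership in the subset. Equal block counts make all
  -- colour classes equally large, and a permutation matching colours fixes the blocks.
  obtain ⟨e, he⟩ := exists_perm_of_card_fiber_eq (f := fun x => (f x, decide (x ∈ Z)))
    (f' := fun x => (f x, decide (x ∈ Z'))) fun ⟨j, b⟩ => by
      have hj := congrFun hZ j
      rw [Fintype.card_subtype, Fintype.card_subtype]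
      cases b
      · have h1 : ∀ Z : Finset (Fin n), Finset.univ.filter
            (fun x => (f x, decide (x ∈ Z)) = (j, false)) = block n a j \ Z := fun Z => by
          ext x
          simp [hf]
        rw [h1, h1, Finset.card_sdiff, Finset.card_sdiff]
        exact congrArg _ hj
      · have h1 : ∀ Z : Finset (Fin n), Finset.univ.filter
            (fun x => (f x, decide (x ∈ Z)) = (j, true)) = Z ∩ block n a j := fun Z => by
          ext x
          simp [hf, and_comm]
        rw [h1, h1]
        exact hj
  simp only [Prod.mk.injEq, decide_eq_decide] at he
  refine ⟨e, ?_, ?_⟩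
  · rw [MulAction.mem_stabilizer_iff]
    refine Subtype.ext (funext fun j => Finset.ext fun y => ?_)
    obtain ⟨x, rfl⟩ := e.surjective y
    rw [OmegaComp.smul_val, mem_perm_smul_finset]
    change x ∈ block n a j ↔ e x ∈ block n a j
    rw [← hf, ← hf, (he x).1]
  · ext y
    obtain ⟨x, rfl⟩ := e.surjective y
    rw [mem_perm_smul_finset, (he x).2]

end Partitions

/-! ### From functions on all subsets to an orthogonal basis of the invariants on `m`-subsets. -/

section Restriction

variable {n : ℕ}

/-- The restriction of a function on all subsets to the `m`-subsets. -/
noncomputable def restrictCard (n m : ℕ) :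
    (Finset (Fin n) → ℂ) →ₗ[ℂ] EuclideanSpace ℂ (Set.powersetCard (Fin n) m) where
  toFun f := WithLp.toLp 2 fun Z => f Z.1
  map_add' _ _ := rfl
  map_smul' _ _ := rfl

theorem restrictCard_blockChar {h : ℕ} {a : Fin h → ℕ} (ha : ∑ j, a j = n) (m : ℕ)
    (x : Fin h → ℕ) : restrictCard n m (blockChar (block n a) x) = sigmaBlocks n a m x := by
  have h1 : blockUnion (block n a) = Finset.univ := (basePartition a ha).blockUnion_eq_univ ha
  refine PiLp.ext fun Z => ?_
  refine if_congr ?_ rfl rfl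
  rw [h1]
  exact and_iff_right (Finset.subset_univ _)

theorem inner_restrictCard (m : ℕ) {f g : Finset (Fin n) → ℂ} (hg : ∀ Z, g Z ≠ 0 → Z.card = m) :
    inner ℂ (restrictCard n m f) (restrictCard n m g) = subsetInner f g := by
  rw [PiLp.inner_apply, subsetInner, ← Finset.sum_subset
    (Finset.subset_univ (Finset.univ.filter fun Z : Finset (Fin n) => Z.card = m))]
  · refine Finset.sum_bij (fun Z _ => Z.1) ?_ ?_ ?_ ?_
    · intro Z _
      simp
    · intro Z _ Z' _ h
      exact Subtype.ext h
    · intro Z hZ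
      exact ⟨⟨Z, by simpa using hZ⟩, Finset.mem_univ _, rfl⟩
    · intro Z _
      exact mul_comm _ _
  · intro Z _ hZ
    have : g Z = 0 := by
      by_contra h
      exact hZ (by simpa using hg Z h)
    rw [this, mul_zero]

theorem Phi_eq_sum (T : PTree) {a : Fin T.leaves → ℕ} (ha : ∑ j, a j = n) (m : ℕ)
    (k : Labeling T) :
    Phi n T a m k = ∑ w ∈ varLabelings T a m k,
      (multiHahn T a m k w : ℂ) • sigmaBlocks n a m (leafCounts T m w) := by
  change restrictCard n m (phiAux T a (block n a) m k) = _
  rw [phiAux_eq_sum, map_sum]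
  refine Finset.sum_congr rfl fun w _ => ?_
  rw [map_smul, restrictCard_blockChar ha]

theorem Phi_mem_invariantFns (T : PTree) {a : Fin T.leaves → ℕ} (ha : ∑ j, a j = n) (m : ℕ)
    (k : Labeling T) : Phi n T a m k ∈
      invariantFns (MulAction.stabilizer (Equiv.Perm (Fin n)) (basePartition a ha)) := by
  rw [Phi_eq_sum T ha]
  exact Submodule.sum_mem _ fun w _ =>
    Submodule.smul_mem _ _ (sigmaBlocks_mem_invariantFns ha m _)

theorem inner_Phi (T : PTree) {a : Fin T.leaves → ℕ} (ha : ∑ j, a j = n) {m : ℕ} (hm : m ≤ n)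
    {k k' : Labeling T} (hk : IsRepLabeling T n a m k) (hk' : IsRepLabeling T n a m k') :
    inner ℂ (Phi n T a m k) (Phi n T a m k') =
      if k = k' then
        ((((n - 2 * repLabel T k).choose (m - repLabel T k) : ℤ) * treeNorm T a k : ℤ) : ℂ)
      else 0 := by
  have hA : DisjointBlocks (block n a) := fun _ _ hij => disjoint_block a hij
  have h := subsetInner_phiAux T a (block n a) hA (card_block a ha) m k k' hk.2 hk'.2
  have h1 := hk.1
  have h2 := hk'.1
  rw [ha] at h
  rw [← h (by omega) (by omega) (by omega) (by omega)]
  exact inner_restrictCard m fun Z hZ => (phiAux_support T a _ hA m k' Z hZ).2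

theorem Phi_ne_zero (T : PTree) {a : Fin T.leaves → ℕ} (ha : ∑ j, a j = n) {m : ℕ} (hm : m ≤ n)
    {k : Labeling T} (hk : IsRepLabeling T n a m k) : Phi n T a m k ≠ 0 := by
  have h := inner_Phi T ha hm hk hk
  rw [if_pos rfl] at h
  intro h0
  rw [h0, inner_zero_left] at h
  have h1 := treeNorm_pos T a k hk.2
  have h2 := hk.1
  have h3 : 0 < (n - 2 * repLabel T k).choose (m - repLabel T k) := Nat.choose_pos (by omega)
  have h4 : (((n - 2 * repLabel T k).choose (m - repLabel T k) : ℤ) * treeNorm T a k) ≠ 0 := by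
    positivity
  exact h4 (by exact_mod_cast h.symm)

/-- Invariant functions depend only on the block counts, hence are combinations of `sigmaBlocks`,
and each of these with attained counts lies in the span by `blockChar_mem_span`. -/
theorem span_Phi (T : PTree) {a : Fin T.leaves → ℕ} (ha : ∑ j, a j = n) {m : ℕ} (hm : m ≤ n) :
    Submodule.span ℂ (Set.range fun k : {k : Labeling T // IsRepLabeling T n a m k} =>
      Phi n T a m k.1) =
      invariantFns (MulAction.stabilizer (Equiv.Perm (Fin n)) (basePartition a ha)) := by
  refine le_antisymm (Submodule.span_le.2 ?_) fun η hη => ?_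
  · rintro _ ⟨k, rfl⟩
    exact Phi_mem_invariantFns T ha m k.1
  · have hsigma : ∀ Z : Set.powersetCard (Fin n) m, sigmaBlocks n a m (blockCounts a Z.1) ∈
        Submodule.span ℂ (Set.range fun k : {k : Labeling T // IsRepLabeling T n a m k} =>
          Phi n T a m k.1) := by
      intro Z
      have hx : ∀ j, blockCounts a Z.1 j ≤ a j := fun j =>
        (Finset.card_le_card Finset.inter_subset_right).trans_eq (card_block a ha j)
      have h := Submodule.mem_map_of_mem (f := restrictCard n m)
        (blockChar_mem_span T a (block n a) (blockCounts a Z.1) hx)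
      rw [restrictCard_blockChar ha, Submodule.map_span, sum_blockCounts ha,
        show Z.1.card = m from Z.2] at h
      refine Submodule.span_mono ?_ h
      rintro _ ⟨_, ⟨k, h1, h2, h3, rfl⟩, rfl⟩
      exact ⟨⟨k, by omega, h1⟩, rfl⟩
    have hfac : ∀ Z Z' : Set.powersetCard (Fin n) m,
        blockCounts a Z.1 = blockCounts a Z'.1 → η Z = η Z' := by
      intro Z Z' h
      obtain ⟨g, hg, hgZ⟩ := exists_smul_eq_of_blockCounts_eq ha h
      have hgZ : g • Z = Z' := Subtype.ext hgZ
      rw [← hη g hg Z, hgZ]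
    -- The value `0` at counts that do not occur is irrelevant: the sum below runs only over
    -- attained counts, which satisfy `x j ≤ a j` and have sum `m`.
    obtain ⟨φ, hφ⟩ : ∃ φ : (Fin T.leaves → ℕ) → ℂ, ∀ Z, η Z = φ (blockCounts a Z.1) :=
      ⟨Function.extend (fun Z : Set.powersetCard (Fin n) m => blockCounts a Z.1) η 0,
        fun Z => (Function.FactorsThrough.extend_apply (fun Z Z' h => hfac Z Z' h) 0 Z).symm⟩
    have hsum : η = ∑ x ∈ Finset.univ.image
        (fun Z : Set.powersetCard (Fin n) m => blockCounts a Z.1),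
          φ x • sigmaBlocks n a m x := by
      refine PiLp.ext fun Z => ?_
      rw [WithLp.ofLp_sum, Finset.sum_apply, Finset.sum_eq_single (blockCounts a Z.1)]
      · rw [hφ]
        simp [sigmaBlocks, blockCounts]
      · intro x _ hx
        have : ¬ ∀ j, (Z.1 ∩ block n a j).card = x j := fun h => hx (funext fun j => (h j).symm)
        simp [sigmaBlocks, this]
      · intro h
        exact absurd (Finset.mem_image_of_mem _ (Finset.mem_univ Z)) h
    rw [hsum]
    refine Submodule.sum_mem _ fun x hx => ?_
    obtain ⟨Z, -, rfl⟩ := Finset.mem_image.1 hx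
    exact Submodule.smul_mem _ _ (hsigma Z)

end Restriction

/-! ### Transfer from `Φ` to `Ψ` and the main theorem. -/

variable {n : ℕ}

/-- Applying `g⁻¹` to both sets preserves the size of `g A_j ∩ Y`; this is why `Φ` and `Ψ` share
their coefficients. -/
theorem sigmaComp_smul_basePartition {h : ℕ} {a : Fin h → ℕ} (ha : ∑ j, a j = n) {m : ℕ}
    (hm : m ≤ n) (x : Fin h → ℕ) (g : Equiv.Perm (Fin n)) :
    sigmaComp n a m hm x (g • basePartition a ha) =
      sigmaBlocks n a m x (g⁻¹ • baseSubset m hm) := by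
  refine if_congr (forall_congr' fun j => ?_) rfl rfl
  change (g • block n a j ∩ (baseSubset m hm).1).card = x j ↔
    (g⁻¹ • (baseSubset m hm).1 ∩ block n a j).card = x j
  rw [← card_smul_inter g⁻¹, inv_smul_smul, Finset.inter_comm]

theorem Phi_inv_smul_baseSubset (T : PTree) {a : Fin T.leaves → ℕ} (ha : ∑ j, a j = n) {m : ℕ}
    (hm : m ≤ n) (k : Labeling T) (g : Equiv.Perm (Fin n)) :
    Phi n T a m k (g⁻¹ • baseSubset m hm) = Psi n T a m hm k (g • basePartition a ha) := by
  rw [Phi_eq_sum T ha, Psi, WithLp.ofLp_sum, WithLp.ofLp_sum, Finset.sum_apply, Finset.sum_apply]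
  refine Finset.sum_congr rfl fun w _ => ?_
  rw [PiLp.smul_apply, PiLp.smul_apply, sigmaComp_smul_basePartition]

end HahnTree

open HahnTree

theorem mainTheorem5 (T : HahnTree.PTree) (n : ℕ) (a : Fin T.leaves → ℕ)
    (ha_pos : ∀ j, 0 < a j) (ha : ∑ j, a j = n) (m : ℕ) (hm : m ≤ n) :
    (∀ k : {k : HahnTree.Labeling T // HahnTree.IsRepLabeling T n a m k},
      HahnTree.Phi n T a m k.1 =
        ∑ w ∈ HahnTree.varLabelings T a m k.1,
          (HahnTree.multiHahn T a m k.1 w : ℂ) •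
            HahnTree.sigmaBlocks n a m (HahnTree.leafCounts T m w)) ∧
    (∃ hPhi : ∀ k : {k : HahnTree.Labeling T // HahnTree.IsRepLabeling T n a m k},
        HahnTree.Phi n T a m k.1 ∈ HahnTree.invariantFns
          (MulAction.stabilizer (Equiv.Perm (Fin n)) (HahnTree.basePartition a ha)),
      ∃ sharp :
        HahnTree.invariantFns (X := Set.powersetCard (Fin n) m)
            (MulAction.stabilizer (Equiv.Perm (Fin n)) (HahnTree.basePartition a ha)) ≃ₗ[ℂ]
          HahnTree.invariantFns (X := HahnTree.OmegaComp n a)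
            (MulAction.stabilizer (Equiv.Perm (Fin n)) (HahnTree.baseSubset m hm)),
        (∀ η, ∀ g : Equiv.Perm (Fin n),
          (sharp η).1 (g • HahnTree.basePartition a ha) =
            η.1 (g⁻¹ • HahnTree.baseSubset m hm)) ∧
        ∀ k : {k : HahnTree.Labeling T // HahnTree.IsRepLabeling T n a m k},
          (sharp ⟨HahnTree.Phi n T a m k.1, hPhi k⟩).1 = HahnTree.Psi n T a m hm k.1) ∧
    (Pairwise fun k k' : {k : HahnTree.Labeling T // HahnTree.IsRepLabeling T n a m k} =>
      inner ℂ (HahnTree.Psi n T a m hm k.1) (HahnTree.Psi n T a m hm k'.1) = 0) ∧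
    LinearIndependent ℂ
      (fun k : {k : HahnTree.Labeling T // HahnTree.IsRepLabeling T n a m k} =>
        HahnTree.Psi n T a m hm k.1) ∧
    Submodule.span ℂ
      (Set.range fun k : {k : HahnTree.Labeling T // HahnTree.IsRepLabeling T n a m k} =>
        HahnTree.Psi n T a m hm k.1) =
      HahnTree.invariantFns
        (MulAction.stabilizer (Equiv.Perm (Fin n)) (HahnTree.baseSubset m hm)) ∧
    ∀ k : {k : HahnTree.Labeling T // HahnTree.IsRepLabeling T n a m k},
      ‖HahnTree.Psi n T a m hm k.1‖ ^ 2 =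
        (((n - m).factorial * m.factorial : ℕ) : ℝ) / ((∏ j, (a j).factorial : ℕ) : ℝ) *
          ‖HahnTree.Phi n T a m k.1‖ ^ 2 := by
  have := OmegaComp.isPretransitive (n := n) ha
  have := Set.powersetCard.isPretransitive (α := Fin n) (n := m)
  have hPhi : ∀ k : {k : Labeling T // IsRepLabeling T n a m k}, Phi n T a m k.1 ∈
      invariantFns (MulAction.stabilizer (Equiv.Perm (Fin n)) (basePartition a ha)) :=
    fun k => Phi_mem_invariantFns T ha m k.1
  set sharp := sharpEquiv (G := Equiv.Perm (Fin n)) (basePartition a ha) (baseSubset m hm) with hsharp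
  have hPsi : ∀ k : {k : Labeling T // IsRepLabeling T n a m k},
      (sharp ⟨Phi n T a m k.1, hPhi k⟩).1 = Psi n T a m hm k.1 := by
    refine fun k => PiLp.ext fun B => ?_
    obtain ⟨g, rfl⟩ := MulAction.exists_smul_eq (Equiv.Perm (Fin n)) (basePartition a ha) B
    rw [hsharp, sharpEquiv_apply, Phi_inv_smul_baseSubset T ha hm k.1 g]
  have hcardY : Fintype.card (Set.powersetCard (Fin n) m) = n.choose m := by
    rw [← Nat.card_eq_fintype_card, Set.powersetCard.card, Nat.card_eq_fintype_card,
      Fintype.card_fin]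
  have hinner : ∀ k k' : {k : Labeling T // IsRepLabeling T n a m k},
      (n.choose m : ℂ) * inner ℂ (Psi n T a m hm k.1) (Psi n T a m hm k'.1) =
        (Fintype.card (OmegaComp n a) : ℂ) * inner ℂ (Phi n T a m k.1) (Phi n T a m k'.1) := by
    intro k k'
    rw [← hPsi k, ← hPsi k', ← hcardY]
    exact card_mul_inner_sharpEquiv _ _ ⟨_, hPhi k⟩ ⟨_, hPhi k'⟩
  have hchoose : (n.choose m : ℂ) ≠ 0 := by exact_mod_cast (Nat.choose_pos hm).ne'
  have horth : Pairwise fun k k' : {k : Labeling T // IsRepLabeling T n a m k} =>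
      inner ℂ (Psi n T a m hm k.1) (Psi n T a m hm k'.1) = 0 := by
    intro k k' hne
    have h := hinner k k'
    rw [inner_Phi T ha hm k.2 k'.2, if_neg (fun h => hne (Subtype.ext h)), mul_zero] at h
    exact (mul_eq_zero.1 h).resolve_left hchoose
  refine ⟨fun k => Phi_eq_sum T ha m k.1, ⟨hPhi, sharp, sharpEquiv_apply _ _, hPsi⟩, horth, ?_, ?_,
    fun k => ?_⟩
  · refine linearIndependent_of_ne_zero_of_inner_eq_zero (fun k h0 => ?_) horth
    rw [← hPsi k, Submodule.coe_eq_zero, LinearEquiv.map_eq_zero_iff, Submodule.mk_eq_zero] at h0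
    exact Phi_ne_zero T ha hm k.2 h0
  · have hspan := span_Phi T ha hm
    -- Spanning is restated inside the subspace of invariants, since `sharp` is defined only there.
    have h1 : Submodule.span ℂ (Set.range fun k : {k : Labeling T // IsRepLabeling T n a m k} =>
        (⟨Phi n T a m k.1, hPhi k⟩ : invariantFns (X := Set.powersetCard (Fin n) m)
            (MulAction.stabilizer (Equiv.Perm (Fin n)) (basePartition a ha)))) = ⊤ := by
      refine Submodule.map_injective_of_injective (Submodule.subtype_injective _) ?_
      rw [Submodule.map_span, ← Set.range_comp, Submodule.map_top, Submodule.range_subtype]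
      exact hspan
    have h2 := congrArg (Submodule.map (Submodule.subtype _ ∘ₗ sharp.toLinearMap)) h1
    rw [Submodule.map_span, ← Set.range_comp, Submodule.map_comp, Submodule.map_top,
      LinearEquiv.range, Submodule.map_top, Submodule.range_subtype] at h2
    rw [← h2]
    congr 2
    exact funext fun k => (hPsi k).symm
  · have h := hinner k k
    rw [inner_self_eq_norm_sq_to_K, inner_self_eq_norm_sq_to_K] at h
    have h' : (n.choose m : ℝ) * ‖Psi n T a m hm k.1‖ ^ 2 =
        (Fintype.card (OmegaComp n a) : ℝ) * ‖Phi n T a m k.1‖ ^ 2 :=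
      Complex.ofReal_injective (by push_cast; exact h)
    have hX : (Fintype.card (OmegaComp n a) : ℝ) * ((∏ j, (a j).factorial : ℕ) : ℝ) =
        n.factorial := by exact_mod_cast OmegaComp.card_mul ha
    have hY : (n.choose m : ℝ) * m.factorial * (n - m).factorial = n.factorial := by
      exact_mod_cast Nat.choose_mul_factorial_mul_factorial hm
    have hP : ((∏ j, (a j).factorial : ℕ) : ℝ) ≠ 0 := by
      exact_mod_cast Finset.prod_ne_zero_iff.2 fun j _ => (a j).factorial_ne_zero
    have hC : (n.choose m : ℝ) ≠ 0 := by exact_mod_cast (Nat.choose_pos hm).ne'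
    -- The ratio `|Ω_a| / |Ω_m|` becomes the stated constant after cancelling `n!` between `hX` and
    -- `hY`.
    rw [div_mul_eq_mul_div, eq_div_iff hP]
    refine mul_left_cancel₀ hC ?_
    rw [Nat.cast_mul]
    linear_combination ((∏ j, (a j).factorial : ℕ) : ℝ) * h' + ‖Phi n T a m k.1‖ ^ 2 * (hX - hY)
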